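/- All logarithms are to base $2$. Let $\phi(m)=2^{\lceil m/16\rceil}$, $m_0=1$, $m_{r}=m_{r-1}\phi(m_{r-1})$, and write $T^\phi(r)=m_r$. For $\epsilon>0$ let $w(1)=\lfloor\log\log(1/\epsilon)\rfloor$, $w(g+1)=\lfloor\log\log T^\phi(w(g))\rfloor$, $N=\lfloor\frac1{48}\sqrt{\log(1/\epsilon)}\rfloor$ and $s=w(N)$. Let $n\ge1$ be divisible by $m_r$ for all $0\le r\le s$, and let $\mathcal P_r$ be the partition of $[n]$ into $m_r$ consecutive intervals (clusters) of equal size. *The weighted graph $H$.* For $1\le r\le s$ let $X_1,\dots,X_m$ ($m=m_{r-1}$) be the clusters of $\mathcal P_{r-1}$ and $X_{i,1},\dots,X_{i,M}$ ($M=\phi(m)$) the clusters of $\mathcal P_r$ inside $X_i$. For every $i$ choose a sequence $(A'_{i,j},B'_{i,j})_{j=1}^m$ of partitions of $[M]$ into two sets that is balanced, i.e. any two distinct elements of $[M]$ lie in the same set of $(A'_{i,j},B'_{i,j})$ for at most $3m/4$ values of $j$; put $A_{i,j}=\bigcup_{t\in A'_{i,j}}X_{i,t}$ and $B_{i,j}=X_i\setminus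 A_{i,j}$. For every $r$, every pair of vertices $(x,y)$ (also $x=y$) that lies in $A_{i,j}\times A_{j,i}$ or in $B_{i,j}\times B_{j,i}$ for some $i,j$ receives weight $4^{-r}/4^{\sqrt{\log(1/\epsilon)}}$. Moreover, for every $1\le g\le N$, with $b=w(g)$, choose a trap $\mathcal O_b$ whose vertices are the clusters of $\mathcal P_b$; every pair $(x,y)\in X\times Y$, with $X,Y\in\mathcal P_b$ adjacent in $\mathcal O_b$, receives additional weight $4^{-g}$. The total weight of $(x,y)$ is $d_H(x,y)$. Here a graph $\mathcal O$ on the $m_b$ clusters of $\mathcal P_b$ is a *trap* if, with $e(R,R')$ the number of ordered pairs in $R\times R'$ that are adjacent in $\mathcal O$, 1. $|e(R,R')-\frac12|R||R'||\le\frac14|R||R'|$ for all sets $R,R'$ of $\lceil\sqrt{m_b}/4\rceil$ vertices; 2. $|e(R,R')-\frac12|R||R'||\le\frac1{k^2}|R||R'|$ for all $b'<b$, all integers $200\le k\le\log m_b$, all $U,U'\in\mathcal P_{b'}$, all sets $R$ of $k^6$ clusters of $\mathcal P_b$ contained in $U$ and all sets $R'$ of $\lceil h/k\rceil$ clusters of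 $\mathcal P_b$ contained in $U'$, where $h=m_b/m_{b'}$ is the number of clusters of $\mathcal P_b$ contained in $U'$. *Notions.* The density of non-empty sets $A,B$ of vertices is $d_H(A,B)=\sum_{x\in A,y\in B}d_H(x,y)/(|A||B|)$. A pair $(A,B)$ of non-empty sets, not necessarily disjoint, is $\gamma$-regular if $|d_H(A',B')-d_H(A,B)|\le\gamma$ for all $A'\subseteq A$, $B'\subseteq B$ with $|A'|\ge\gamma|A|$, $|B'|\ge\gamma|B|$. We write $Z\subset_\beta X$ if $|Z\cap X|\ge(1-\beta)|Z|$. Given $1\le r\le s$, with $X_i$, $A_{i,j}$, $B_{i,j}$ as above, a pair $(Z,U)$ is $\beta$-helpful if there are $i,j$ (possibly equal) with $Z\subset_\beta X_i$, $U\subset_\beta X_j$ and $\min(|Z\cap A_{i,j}|,|Z\cap B_{i,j}|)\ge\beta^2|Z|$. **Statement.** There is an absolute constant $\epsilon_0>0$ such that the following holds for every $0<\epsilon\le\epsilon_0$, every $n$ as above and every graph $H$ obtained as above (for all choices of the balanced sequences and of the traps). Let $0<\gamma\le\epsilon$, $\gamma^{1/4}\le\beta\le\frac1{100}$, and let $1\le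 r\le s$ be an integer with $r<\frac{\log(1/\gamma)}{10\sqrt{\log(1/\epsilon)}}$; put $m=m_{r-1}$. Let $\mathcal Z$ be a partition of $[n]$ into $k$ sets of equal size, let $Z\in\mathcal Z$ and $X_i,X_j\in\mathcal P_{r-1}$ with $Z\subset_\beta X_i$, and let $\mathcal S\subseteq\mathcal Z$ be a collection of at least $\frac{k}{2m}$ sets $U$ such that $U\subset_\beta X_j$ and $(Z,U)$ is $\beta$-helpful. Then for at least $\frac{k}{4m}$ of the sets $U\in\mathcal S$ the pair $(Z,U)$ is not $\gamma$-regular in $H$. -/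

import Mathlib

namespace StrongReg

/-! All logarithms are to base two. -/

/-- `φ(m) = 2 ^ ⌈m / 16⌉` (the ceiling is written with truncating division). -/
def phi (m : ℕ) : ℕ := 2 ^ ((m + 15) / 16)

/-- The order `m_r` of the `r`-th canonical partition, that is `T^φ(r)`:
`m_0 = 1` and `m_{r+1} = m_r * φ(m_r)`. -/
def order : ℕ → ℕ
  | 0 => 1
  | r + 1 => order r * phi (order r)

/-- `√(log (1/ε))`. -/
noncomputable def sqrtLog (ε : ℝ) : ℝ := √(Real.logb 2 (1 / ε))

/-- The levels `w(1), w(2), …` on which traps are placed: `w(1) = ⌊log log (1/ε)⌋` and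
`w(g+1) = ⌊log log T^φ(w(g))⌋`. The value at `0` is not used. -/
noncomputable def trapLevel (ε : ℝ) : ℕ → ℕ
  | 0 => 0
  | 1 => ⌊Real.logb 2 (Real.logb 2 (1 / ε))⌋₊
  | g + 2 => ⌊Real.logb 2 (Real.logb 2 (order (trapLevel ε (g + 1)) : ℝ))⌋₊

/-- The number of traps, `⌊√(log (1/ε)) / 48⌋`. -/
noncomputable def numTraps (ε : ℝ) : ℕ := ⌊sqrtLog ε / 48⌋₊

/-- The index `s = w(⌊√(log (1/ε)) / 48⌋)` of the last canonical partition. -/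
noncomputable def lastLevel (ε : ℝ) : ℕ := trapLevel ε (numTraps ε)

/-- The `i`-th cluster of the canonical partition `P_r` of the vertex set `Fin n`
(for `m_r ∣ n`): the `i`-th of the `m_r` consecutive intervals of length `n / m_r`. -/
def cluster (n r : ℕ) (i : Fin (order r)) : Finset (Fin n) :=
  Finset.univ.filter fun x => (x : ℕ) / (n / order r) = (i : ℕ)

/-- The `t`-th cluster of `P_{r+1}` inside the `i`-th cluster of `P_r`
(it has index `i * φ(m_r) + t` in `P_{r+1}`). -/
def subcluster (n r : ℕ) (i : Fin (order r)) (t : Fin (phi (order r))) : Finset (Fin n) :=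
  cluster n (r + 1) (finProdFinEquiv (i, t) : Fin (order r * phi (order r)))

/-- A sequence `(A_i, B_i)`, `i < m`, of partitions of `[M]` into two sets, given by the sets `A_i`
(so `B_i` is the complement of `A_i`), is balanced if any two distinct elements of `[M]` lie in the
same set of `(A_i, B_i)` for at most `3m/4` of the indices `i`. -/
def IsBalanced {m M : ℕ} (A : Fin m → Finset (Fin M)) : Prop :=
  ∀ j j' : Fin M, j ≠ j' →
    ((Finset.univ.filter fun i => (j ∈ A i ↔ j' ∈ A i)).card : ℝ) ≤ 3 * (m : ℝ) / 4

open Classical in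
/-- `e(R, R')`: the number of edges between `R` and `R'`, where the edges inside `R ∩ R'` are
counted twice; that is, the number of adjacent ordered pairs in `R × R'`. -/
noncomputable def edgeCount {V : Type*} (O : SimpleGraph V) (R R' : Finset V) : ℕ :=
  ((R ×ˢ R').filter fun p => O.Adj p.1 p.2).card

/-- Traps. The vertex `v` of `O` stands for the `v`-th cluster of `P_b`, so the set of the vertices
that stand for subsets of the `i`-th cluster of `P_{b'}` is the `i`-th of `m_{b'}` consecutive
intervals of the vertex set `Fin m_b`, i.e. `cluster (order b) b' i`. -/
structure IsTrap (b : ℕ) (O : SimpleGraph (Fin (order b))) : Prop where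
  global : ∀ R R' : Finset (Fin (order b)),
    R.card = ⌈√(order b : ℝ) / 4⌉₊ → R'.card = ⌈√(order b : ℝ) / 4⌉₊ →
      |(edgeCount O R R' : ℝ) - 1 / 2 * R.card * R'.card| ≤ 1 / 4 * R.card * R'.card
  local_ : ∀ b' < b, ∀ i j : Fin (order b'), ∀ k : ℕ,
    200 ≤ k → (k : ℝ) ≤ Real.logb 2 (order b) →
    ∀ R ⊆ cluster (order b) b' i, ∀ R' ⊆ cluster (order b) b' j,
      R.card = k ^ 6 → R'.card = ⌈((cluster (order b) b' j).card : ℝ) / k⌉₊ →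
        |(edgeCount O R R' : ℝ) - 1 / 2 * R.card * R'.card| ≤
          1 / (k : ℝ) ^ 2 * R.card * R'.card

/-- The choices made in the construction of the weighted graph `H`. -/
structure Choices (ε : ℝ) where
  /-- `A r i j ⊆ [φ(m_r)]` is the first set of the `j`-th of the two-set partitions of the clusters
  of `P_{r+1}` inside the `i`-th cluster of `P_r`. Only `r < s` is used. -/
  A : ∀ r : ℕ, Fin (order r) → Fin (order r) → Finset (Fin (phi (order r)))
  balanced : ∀ r < lastLevel ε, ∀ i, IsBalanced (A r i)
  /-- The graph used for the `g`-th trap, placed on `P_{w(g)}`.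
  Only `1 ≤ g ≤ √(log (1/ε)) / 48` is used. -/
  O : ∀ g : ℕ, SimpleGraph (Fin (order (trapLevel ε g)))
  isTrap : ∀ g, 1 ≤ g → g ≤ numTraps ε → IsTrap (trapLevel ε g) (O g)

namespace Choices

variable {ε : ℝ} (C : Choices ε)

/-- The subset `A_{i,j}` of the `i`-th cluster of `P_r`. -/
def setA (n r : ℕ) (i j : Fin (order r)) : Finset (Fin n) :=
  (C.A r i j).biUnion (subcluster n r i)

/-- The subset `B_{i,j}` of the `i`-th cluster of `P_r`. -/
def setB (n r : ℕ) (i j : Fin (order r)) : Finset (Fin n) :=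
  ((C.A r i j)ᶜ).biUnion (subcluster n r i)

open Classical in
/-- The weights of the graph `G`: for `1 ≤ r ≤ s` (written `r + 1` with `r < s`), the pair `(x, y)`
receives `4 ^ (-r) / 4 ^ √(log (1/ε))` if it lies in some `A_{i,j} × A_{j,i}` or
`B_{i,j} × B_{j,i}`, where `i, j` range over the clusters of `P_{r-1}`. -/
noncomputable def weightG (n : ℕ) (x y : Fin n) : ℝ :=
  ∑ r ∈ Finset.range (lastLevel ε),
    if ∃ i j : Fin (order r),
        (x ∈ C.setA n r i j ∧ y ∈ C.setA n r j i) ∨ (x ∈ C.setB n r i j ∧ y ∈ C.setB n r j i)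
    then ((4 : ℝ) ^ (r + 1))⁻¹ / (4 : ℝ) ^ sqrtLog ε else 0

open Classical in
/-- The weights added by the traps: the `g`-th trap adds `4 ^ (-g)` to all pairs of vertices between
two clusters of `P_{w(g)}` that are adjacent in the graph used for the trap. -/
noncomputable def weightTraps (n : ℕ) (x y : Fin n) : ℝ :=
  ∑ g ∈ Finset.Icc 1 (numTraps ε),
    if ∃ i j : Fin (order (trapLevel ε g)), (C.O g).Adj i j ∧
        x ∈ cluster n (trapLevel ε g) i ∧ y ∈ cluster n (trapLevel ε g) j
    then ((4 : ℝ) ^ g)⁻¹ else 0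

/-- The weights `d_H(x, y)` of the graph `H` on the vertex set `Fin n`. -/
noncomputable def weightH (n : ℕ) (x y : Fin n) : ℝ :=
  C.weightG n x y + C.weightTraps n x y

end Choices

/-- The weighted density `d(A, B)`. -/
noncomputable def density {V : Type*} (d : V → V → ℝ) (A B : Finset V) : ℝ :=
  (∑ x ∈ A, ∑ y ∈ B, d x y) / ((A.card : ℝ) * (B.card : ℝ))

/-- `(A, B)` is a `γ`-regular pair of the weighted graph with weights `d`. -/
def IsRegularPair {V : Type*} (d : V → V → ℝ) (γ : ℝ) (A B : Finset V) : Prop :=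
  ∀ A' ⊆ A, ∀ B' ⊆ B, γ * (A.card : ℝ) ≤ A'.card → γ * (B.card : ℝ) ≤ B'.card →
    |density d A' B' - density d A B| ≤ γ

/-- `Z ⊂_β X`. -/
def BetaSubset {n : ℕ} (β : ℝ) (Z X : Finset (Fin n)) : Prop :=
  (1 - β) * (Z.card : ℝ) ≤ ((Z ∩ X).card : ℝ)

/-- The pair `(Z, U)` is `β`-helpful with respect to the canonical partition `P_r` (and the
partitions of its clusters into sets of `P_{r+1}`). -/
def Choices.IsHelpful {ε : ℝ} (C : Choices ε) (n r : ℕ) (β : ℝ) (Z U : Finset (Fin n)) : Prop :=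
  ∃ i j : Fin (order r), BetaSubset β Z (cluster n r i) ∧ BetaSubset β U (cluster n r j) ∧
    β ^ 2 * (Z.card : ℝ) ≤
      min ((Z ∩ C.setA n r i j).card : ℝ) ((Z ∩ C.setB n r i j).card : ℝ)

end StrongReg

namespace StrongReg

/-! ### Growth of the orders of the canonical partitions -/

/-! Suppose too few of the pairs are irregular. Then the sets `U ∈ S` for which `(Z, U)` is regular
cover at least a fifth of `X = X_j`. Choose `A ⊆ Z ∩ A_{i,j}` and `B ⊆ Z ∩ B_{i,j}`, each with at
least `γ|Z|` elements, and let `D(y)` be the average weight from `A` to `y` minus that from `B` to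
`y`. Regularity makes every partial sum of `D` over the covered part of `X` at most `3γ|X|` in
absolute value (`abs_sum_avg_sub_avg_le_of_cover`), so `|D|` is tiny at most covered points. The
contradiction is that `D` cannot be that small.

The graph `G` contributes about `±η` to `D(y)`, where `η` is `levelWeight ε q`: coarser levels
cancel because `A` and `B` lie in the same cluster, and finer levels have total weight at most `η /
3` (`weightG_sub_bounds`). It remains to show that the traps, whose weights `4^(-g)` are far larger
than `η`, cannot cancel this.

For this, `A` and `B` are chosen to be constant on the clusters of the first `t` traps and spread
over the clusters of all later ones (`exists_subset_concentrated_spread`). Concentrated traps have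
density exactly `0` or `1` to each `y`; spread ones average about `1/2` over large sets of `y`, by
the local trap property (`abs_sum_trapInd_le`). Let `tA`, `tB` be the two thresholds. If they
differ, then at the first level after the smaller one a `0`-`1` function is compared with one of
mean `1/2`, and the finer traps are too light to repair the discrepancy
(`not_close_of_concentrated`). If they agree, the concentrated traps contribute a multiple of
`4^(-t)`, hence `0`, and the spread ones nearly cancel on average, so the `±η` from `G` survives.
This is `false_of_small_partial_sums`. -/

lemma order_pos (r : ℕ) : 0 < order r := by
  induction r with
  | zero => simp [order]
  | succ r ih => simp only [order, phi]; positivity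

lemma order_dvd_order {a b : ℕ} (h : a ≤ b) : order a ∣ order b := by
  induction b, h using Nat.le_induction with
  | base => exact dvd_rfl
  | succ b _ ih => exact ih.trans (Dvd.intro _ rfl)

/-- The summand `4` pays for the division by `16` in `phi`. -/
lemma two_pow_two_pow_le_order_succ {a b : ℕ} (h : 2 ^ (a + 4) ≤ order b) :
    2 ^ 2 ^ a ≤ order (b + 1) := by
  have h1 : 2 ^ a ≤ (order b + 15) / 16 := by
    rw [Nat.le_div_iff_mul_le (by norm_num)]
    rw [pow_add] at h
    omega
  calc 2 ^ 2 ^ a ≤ phi (order b) := Nat.pow_le_pow_right (by norm_num) h1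
    _ ≤ order b * phi (order b) := Nat.le_mul_of_pos_left _ (order_pos b)

lemma two_pow_le_order_seven : 2 ^ 15 ≤ order 7 := by
  simp [order, phi]

lemma two_pow_two_pow_le_order_succ' {c d b : ℕ} (hcd : c + 4 ≤ 2 ^ d) (h : 2 ^ 2 ^ d ≤ order b) :
    2 ^ 2 ^ c ≤ order (b + 1) :=
  two_pow_two_pow_le_order_succ (le_trans (Nat.pow_le_pow_right (by norm_num) hcd) h)

lemma two_pow_two_pow_le_order_ten {c : ℕ} (hc : c + 4 ≤ 2 ^ 11) : 2 ^ 2 ^ c ≤ order 10 :=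
  two_pow_two_pow_le_order_succ' hc <|
    two_pow_two_pow_le_order_succ' (d := 11) (by norm_num) <|
      two_pow_two_pow_le_order_succ two_pow_le_order_seven

/-- The orders grow slowly up to `m_7 = 2^15`; three further steps give the base case, and
afterwards each step of the recursion costs about one exponential. The point is that `log log m_b`
is at least `2^b`, so that `log log m_b ≥ b` and `log m_b` exceeds every parameter used with the
traps. -/
lemma tower_le_order {b : ℕ} (hb : 10 ≤ b) : 2 ^ 2 ^ 2 ^ b ≤ order b := by
  induction b, hb using Nat.le_induction with
  | base => exact two_pow_two_pow_le_order_ten (c := 2 ^ 10) (by norm_num)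
  | succ b hb ih =>
    refine two_pow_two_pow_le_order_succ (le_trans (Nat.pow_le_pow_right (by norm_num) ?_) ih)
    have h1 : b + 2 ≤ 2 ^ b := by
      have : b ≤ 2 ^ (b - 1) := by
        have := Nat.lt_two_pow_self (n := b - 1)
        omega
      have h2 : 2 ^ b = 2 * 2 ^ (b - 1) := by
        rw [← pow_succ']; congr 1; omega
      omega
    have h2 : 2 ^ (b + 2) ≤ 2 ^ 2 ^ b := Nat.pow_le_pow_right (by norm_num) h1
    have h3 : 2 ^ (b + 2) = 2 * 2 ^ (b + 1) := by ring
    have h4 : 4 ≤ 2 ^ (b + 1) := by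
      calc 4 = 2 ^ 2 := by norm_num
        _ ≤ 2 ^ (b + 1) := Nat.pow_le_pow_right (by norm_num) (by omega)
    omega

lemma two_pow_two_pow_le_logb_order {b : ℕ} (hb : 10 ≤ b) :
    (2 : ℝ) ^ (2 ^ b : ℕ) ≤ Real.logb 2 (order b) := by
  rw [Real.le_logb_iff_rpow_le (by norm_num) (by exact_mod_cast order_pos b)]
  have := tower_le_order hb
  have h2 : ((2 ^ 2 ^ 2 ^ b : ℕ) : ℝ) ≤ order b := by exact_mod_cast this
  refine le_trans (le_of_eq ?_) h2
  rw [show ((2 : ℝ) ^ (2 ^ b : ℕ)) = ((2 ^ 2 ^ b : ℕ) : ℝ) by push_cast; rfl, Real.rpow_natCast]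
  push_cast
  rfl

/-! ### The levels of the traps -/

lemma trapLevel_le_succ {ε : ℝ} {g : ℕ} (hb : 10 ≤ trapLevel ε (g + 1)) :
    trapLevel ε (g + 1) ≤ trapLevel ε (g + 2) := by
  change _ ≤ ⌊Real.logb 2 (Real.logb 2 (order (trapLevel ε (g + 1)) : ℝ))⌋₊
  set b := trapLevel ε (g + 1)
  apply Nat.le_floor
  have h1 := two_pow_two_pow_le_logb_order hb
  have h2 : (0 : ℝ) < (2 : ℝ) ^ (2 ^ b : ℕ) := by positivity
  rw [Real.le_logb_iff_rpow_le (by norm_num) (h2.trans_le h1), Real.rpow_natCast]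
  refine le_trans (pow_le_pow_right₀ (by norm_num) ?_) h1
  exact Nat.lt_two_pow_self.le

lemma trapLevel_one_le {ε : ℝ} (h : 10 ≤ trapLevel ε 1) (g : ℕ) :
    trapLevel ε 1 ≤ trapLevel ε (g + 1) := by
  induction g with
  | zero => rfl
  | succ g ih => exact ih.trans (trapLevel_le_succ (h.trans ih))

/-- Makes the partitions carrying successive traps refine one another, and keeps all of them at or
below level `s`. -/
lemma trapLevel_mono {ε : ℝ} (h : 10 ≤ trapLevel ε 1) {g g' : ℕ} (hg : 1 ≤ g) (hgg : g ≤ g') :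
    trapLevel ε g ≤ trapLevel ε g' := by
  induction g', hgg using Nat.le_induction with
  | base => rfl
  | succ g' hg' ih =>
    obtain ⟨d, rfl⟩ : ∃ d, g' = d + 1 := ⟨g' - 1, by omega⟩
    exact ih.trans (trapLevel_le_succ (h.trans (trapLevel_one_le h d)))

/-! ### The parameters -/

/-- The weight `4 ^ (-(q + 1)) / 4 ^ √(log (1/ε))` of a pair at level `q + 1`. -/
noncomputable def levelWeight (ε : ℝ) (q : ℕ) : ℝ := ((4 : ℝ) ^ (q + 1))⁻¹ / (4 : ℝ) ^ sqrtLog ε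

/-- The parameter with which the local property of the traps is applied. -/
noncomputable def trapParam (ε : ℝ) (q : ℕ) : ℕ := ⌈256 / levelWeight ε q⌉₊

lemma levelWeight_pos (ε : ℝ) (q : ℕ) : 0 < levelWeight ε q := by
  unfold levelWeight; positivity

lemma levelWeight_eq (ε : ℝ) (q : ℕ) :
    levelWeight ε q = (2 : ℝ) ^ (-(2 * ((q + 1 : ℕ) : ℝ) + 2 * sqrtLog ε)) := by
  unfold levelWeight
  rw [show (4 : ℝ) = 2 ^ (2 : ℝ) by norm_num, ← Real.rpow_natCast, ← Real.rpow_mul (by norm_num),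
    ← Real.rpow_mul (by norm_num), ← Real.rpow_neg (by norm_num), ← Real.rpow_sub (by norm_num)]
  congr 1
  ring

lemma trapParam_ge (ε : ℝ) (q : ℕ) : 256 / levelWeight ε q ≤ trapParam ε q := Nat.le_ceil _

lemma levelWeight_le (ε : ℝ) (q : ℕ) : levelWeight ε q ≤ 1 := by
  rw [levelWeight_eq]
  apply Real.rpow_le_one_of_one_le_of_nonpos (by norm_num)
  have : 0 ≤ sqrtLog ε := Real.sqrt_nonneg _
  have : (0 : ℝ) ≤ ((q + 1 : ℕ) : ℝ) := by positivity
  linarith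

lemma trapParam_ge_256 (ε : ℝ) (q : ℕ) : 256 ≤ trapParam ε q := by
  have h := trapParam_ge ε q
  have h1 : (256 : ℝ) ≤ 256 / levelWeight ε q := by
    rw [le_div_iff₀ (levelWeight_pos ε q)]
    linarith [levelWeight_le ε q]
  exact_mod_cast h1.trans h

lemma trapParam_le (ε : ℝ) (q : ℕ) :
    (trapParam ε q : ℝ) ≤ (2 : ℝ) ^ (2 * ((q + 1 : ℕ) : ℝ) + 2 * sqrtLog ε + 9) := by
  have h := (Nat.ceil_lt_add_one (a := 256 / levelWeight ε q)
    (by have := levelWeight_pos ε q; positivity)).le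
  have h1 : (1 : ℝ) ≤ 256 / levelWeight ε q := by
    rw [le_div_iff₀ (levelWeight_pos ε q)]
    linarith [levelWeight_le ε q]
  have h2 : (2 : ℝ) ^ (2 * ((q + 1 : ℕ) : ℝ) + 2 * sqrtLog ε + 9) = 512 / levelWeight ε q := by
    rw [levelWeight_eq, Real.rpow_neg (by norm_num), Real.rpow_add (by norm_num) _ 9, div_inv_eq_mul]
    norm_num
    ring
  rw [h2]
  have h3 : 512 / levelWeight ε q = 2 * (256 / levelWeight ε q) := by ring
  unfold trapParam
  linarith

section parameters

variable {ε : ℝ} (hL : 1024 ≤ Real.logb 2 (1 / ε))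

include hL

lemma ten_le_trapLevel_one : 10 ≤ trapLevel ε 1 := by
  apply Nat.le_floor
  rw [Real.le_logb_iff_rpow_le (by norm_num) (by linarith)]
  norm_num at *
  exact hL

lemma sqrtLog_sq : sqrtLog ε ^ 2 = Real.logb 2 (1 / ε) := Real.sq_sqrt (by linarith)

lemma le_sqrtLog : 32 ≤ sqrtLog ε := by
  apply Real.le_sqrt_of_sq_le
  linarith

lemma sqrtLog_sq_lt : sqrtLog ε ^ 2 < 2 ^ (trapLevel ε 1 + 1) := by
  rw [sqrtLog_sq hL]
  have h := Nat.lt_floor_add_one (Real.logb 2 (Real.logb 2 (1 / ε)))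
  rw [Real.logb_lt_iff_lt_rpow (by norm_num) (by linarith)] at h
  have : (2 : ℝ) ^ (trapLevel ε 1 + 1) = 2 ^ (((trapLevel ε 1 : ℕ) : ℝ) + 1) := by
    rw [← Real.rpow_natCast]; push_cast; rfl
  rw [this]
  exact h

/-- Admissibility of `trapParam` in the local trap property: its logarithm is at most `2b + 2√(log
(1/ε)) + 9`, and `√(log (1/ε)) ≤ 2^b / 8` because `b ≥ w(1)`, whereas `log m_b ≥ 2^(2^b)`. -/
lemma trapParam_le_logb_order {q g : ℕ} (hg : 1 ≤ g) (hq : q < trapLevel ε g) :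
    (trapParam ε q : ℝ) ≤ Real.logb 2 (order (trapLevel ε g)) := by
  have h10 := ten_le_trapLevel_one hL
  have h1 := trapLevel_mono h10 le_rfl hg
  set b := trapLevel ε g
  have hb : 10 ≤ b := h10.trans h1
  refine (trapParam_le ε q).trans (le_trans ?_ (two_pow_two_pow_le_logb_order hb))
  rw [← Real.rpow_natCast]
  apply Real.rpow_le_rpow_of_exponent_le (by norm_num)
  have hl : sqrtLog ε ^ 2 < 2 ^ (b + 1) :=
    (sqrtLog_sq_lt hL).trans_le (pow_le_pow_right₀ (by norm_num) (by omega))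
  have hq' : ((q + 1 : ℕ) : ℝ) ≤ b := by exact_mod_cast hq
  have h5 : ∀ b : ℕ, 10 ≤ b → 1024 ≤ 2 ^ b ∧ 4 * b + 18 ≤ 2 ^ b := by
    intro b hb
    induction b, hb using Nat.le_induction with
    | base => norm_num
    | succ b hb ih => rw [pow_succ]; omega
  obtain ⟨h6, h7⟩ := h5 b hb
  have h6' : (1024 : ℝ) ≤ 2 ^ b := by exact_mod_cast h6
  have h7' : 4 * (b : ℝ) + 18 ≤ 2 ^ b := by exact_mod_cast h7
  rw [pow_succ 2 b] at hl
  push_cast at hq' ⊢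
  have h8 : sqrtLog ε ≤ 2 ^ b / 8 := by
    apply le_of_not_gt
    intro h
    nlinarith
  linarith

variable {γ : ℝ} {q : ℕ} (hγ : 0 < γ) (hγε : γ ≤ ε)
  (hq : ((q + 1 : ℕ) : ℝ) < Real.logb 2 (1 / γ) / (10 * √(Real.logb 2 (1 / ε))))

include hγ hγε hq

lemma logb_inv_bounds : sqrtLog ε ^ 2 ≤ Real.logb 2 (1 / γ) ∧
    10 * ((q + 1 : ℕ) : ℝ) * sqrtLog ε ≤ Real.logb 2 (1 / γ) := by
  constructor
  · rw [sqrtLog_sq hL]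
    apply Real.logb_le_logb_of_le (by norm_num) (by have := hγ.trans_le hγε; positivity)
    exact one_div_le_one_div_of_le hγ hγε
  · change _ < _ / (10 * sqrtLog ε) at hq
    have := le_sqrtLog hL
    rw [lt_div_iff₀ (by positivity)] at hq
    linarith

omit hL hγε hq in
lemma eq_two_rpow_neg : γ = (2 : ℝ) ^ (-Real.logb 2 (1 / γ)) := by
  rw [one_div, Real.logb_inv, neg_neg, Real.rpow_logb (by norm_num) (by norm_num) hγ]

lemma le_levelWeight : 10000 * γ ≤ levelWeight ε q := by
  obtain ⟨h1, h2⟩ := logb_inv_bounds hL hγ hγε hq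
  have h3 := le_sqrtLog hL
  have h4 : (1 : ℝ) ≤ ((q + 1 : ℕ) : ℝ) := by exact_mod_cast Nat.succ_pos q
  rw [levelWeight_eq]
  have : 10000 * γ ≤ 2 ^ (14 : ℝ) * γ := by gcongr; norm_num
  refine this.trans ?_
  rw [eq_two_rpow_neg hγ, ← Real.rpow_add (by norm_num)]
  apply Real.rpow_le_rpow_of_exponent_le (by norm_num)
  nlinarith

/-- The right side is the proportion of a set that survives when it is made concentrated or spread
at all traps. The number of traps and the bound on `r` are such that this loses at most a factor
`√γ`; the other factor `√γ` is spent on `β² ≥ √γ`. -/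
lemma sqrt_le_trapParam_pow : γ ^ (1 / 2 : ℝ) ≤ ((trapParam ε q : ℝ) ^ 7)⁻¹ ^ numTraps ε := by
  obtain ⟨h1, h2⟩ := logb_inv_bounds hL hγ hγε hq
  have h3 := le_sqrtLog hL
  have h4 : (1 : ℝ) ≤ ((q + 1 : ℕ) : ℝ) := by exact_mod_cast Nat.succ_pos q
  have hN : (numTraps ε : ℝ) ≤ sqrtLog ε / 48 := Nat.floor_le (by positivity)
  have hk := trapParam_le ε q
  have hk0 : (0 : ℝ) < trapParam ε q := by
    exact_mod_cast lt_of_lt_of_le (by norm_num) (trapParam_ge_256 ε q)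
  set R : ℝ := ((q + 1 : ℕ) : ℝ)
  set l := sqrtLog ε
  have h5 : (trapParam ε q : ℝ) ^ (7 * numTraps ε) ≤
      (2 : ℝ) ^ (7 * (l / 48) * (2 * R + 2 * l + 9)) := by
    calc (trapParam ε q : ℝ) ^ (7 * numTraps ε)
        ≤ ((2 : ℝ) ^ (2 * R + 2 * l + 9)) ^ (7 * numTraps ε) := by gcongr
      _ = (2 : ℝ) ^ ((2 * R + 2 * l + 9) * (7 * (numTraps ε : ℝ))) := by
        rw [← Real.rpow_natCast, ← Real.rpow_mul (by norm_num)]; push_cast; rfl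
      _ ≤ _ := by
        apply Real.rpow_le_rpow_of_exponent_le (by norm_num)
        nlinarith
  have h6 : ((trapParam ε q : ℝ) ^ 7)⁻¹ ^ numTraps ε =
      ((trapParam ε q : ℝ) ^ (7 * numTraps ε))⁻¹ := by rw [inv_pow, pow_mul]
  rw [h6]
  refine le_trans ?_ (inv_anti₀ (by positivity) h5)
  rw [← Real.rpow_neg (by norm_num)]
  nth_rw 1 [eq_two_rpow_neg hγ]
  rw [← Real.rpow_mul (by norm_num)]
  apply Real.rpow_le_rpow_of_exponent_le (by norm_num)
  nlinarith

omit hγ hγε hq in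
-- Even the lightest trap dominates `G`: `t ≤ √(log (1/ε)) / 48`, while `levelWeight` contains the
-- factor `4^(-√(log (1/ε)))`.
lemma levelWeight_le_trapWeight {t : ℕ} (ht : t ≤ numTraps ε) :
    100 * levelWeight ε q ≤ ((4 : ℝ) ^ t)⁻¹ := by
  have h3 := le_sqrtLog hL
  have hN : (numTraps ε : ℝ) ≤ sqrtLog ε / 48 := Nat.floor_le (by positivity)
  have ht' : (t : ℝ) ≤ numTraps ε := by exact_mod_cast ht
  have h4 : (1 : ℝ) ≤ ((q + 1 : ℕ) : ℝ) := by exact_mod_cast Nat.succ_pos q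
  rw [levelWeight_eq]
  have h5 : ((4 : ℝ) ^ t)⁻¹ = 2 ^ (-(2 * (t : ℝ))) := by
    rw [Real.rpow_neg (by norm_num), Real.rpow_mul (by norm_num), Real.rpow_natCast]
    norm_num
  rw [h5]
  have : 100 * (2 : ℝ) ^ (-(2 * ((q + 1 : ℕ) : ℝ) + 2 * sqrtLog ε)) ≤
      2 ^ (7 : ℝ) * (2 : ℝ) ^ (-(2 * ((q + 1 : ℕ) : ℝ) + 2 * sqrtLog ε)) := by gcongr; norm_num
  refine this.trans ?_
  rw [← Real.rpow_add (by norm_num)]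
  apply Real.rpow_le_rpow_of_exponent_le (by norm_num)
  linarith

end parameters

open Finset

/-! ### Vertices with exceptional degree in a trap -/

section exceptional

variable {V V' : Type*} {P : Finset V} {Q : Finset V'} {c : V → V' → ℝ} {k : ℕ}

/-- Fewer than `⌈|Q|/k⌉` of the `u` have column sum over `R` above `|R|/k²`, since otherwise that
many of them would violate `h`. These contribute at most `|R|` each and the others at most `|R|/k²`
each. The weights `w` allow for sets that contain only a fraction of each cluster. -/
lemma sum_weighted_le (hk : 1 ≤ k) (hc : ∀ v u, |c v u| ≤ 1)
    (h : ∀ R ⊆ P, ∀ R' ⊆ Q, R.card = k ^ 6 → R'.card = ⌈(Q.card : ℝ) / k⌉₊ →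
      |∑ v ∈ R, ∑ u ∈ R', c v u| ≤ 1 / (k : ℝ) ^ 2 * R.card * R'.card)
    {w : V' → ℝ} (hw0 : ∀ u, 0 ≤ w u) (hw1 : ∀ u, w u ≤ 1) {R : Finset V} (hR : R ⊆ P)
    (hRc : R.card = k ^ 6) :
    ∑ v ∈ R, ∑ u ∈ Q, w u * c v u ≤ R.card * (2 * Q.card / k) := by
  classical
  have hk' : (1 : ℝ) ≤ k := by exact_mod_cast hk
  rw [sum_comm]
  simp_rw [← mul_sum]
  rcases Q.eq_empty_or_nonempty with rfl | hQ
  · simp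
  have hQ0 : (0 : ℝ) < Q.card := by exact_mod_cast hQ.card_pos
  set d : V' → ℝ := fun u => ∑ v ∈ R, c v u
  have hd : ∀ u, d u ≤ R.card := fun u => by
    calc d u ≤ ∑ v ∈ R, (1 : ℝ) := sum_le_sum fun v _ => (abs_le.1 (hc v u)).2
      _ = R.card := by simp
  set T := Q.filter fun u => (R.card : ℝ) / k ^ 2 < d u with hT
  have hTc : (T.card : ℝ) ≤ Q.card / k := by
    by_contra hcon
    push Not at hcon
    have h1 : ⌈(Q.card : ℝ) / k⌉₊ ≤ T.card := Nat.ceil_le.2 hcon.le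
    obtain ⟨R', hR'T, hR'c⟩ := exists_subset_card_eq h1
    have h2 := (abs_le.1 (h R hR R' (hR'T.trans (filter_subset _ _)) hRc hR'c)).2
    rw [sum_comm] at h2
    have hne : R'.Nonempty := by
      rw [← card_pos, hR'c]
      exact Nat.ceil_pos.2 (by positivity)
    have h3 : ∑ u ∈ R', (R.card : ℝ) / k ^ 2 < ∑ u ∈ R', d u :=
      sum_lt_sum_of_nonempty hne fun u hu => (mem_filter.1 (hR'T hu)).2
    rw [sum_const, nsmul_eq_mul] at h3
    have h4 : (R'.card : ℝ) * ((R.card : ℝ) / k ^ 2) = 1 / (k : ℝ) ^ 2 * R.card * R'.card := by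
      ring
    exact absurd h2 (not_le.2 (h4 ▸ h3))
  have h5 : ∀ u ∈ Q, w u * d u ≤ (if u ∈ T then (R.card : ℝ) else 0) + R.card / k ^ 2 := by
    intro u hu
    have hnn : (0 : ℝ) ≤ R.card / k ^ 2 := by positivity
    split_ifs with huT
    · have : w u * d u ≤ 1 * R.card :=
        (mul_le_mul_of_nonneg_left (hd u) (hw0 u)).trans
          (mul_le_mul_of_nonneg_right (hw1 u) (by positivity))
      linarith
    · have hdu : d u ≤ R.card / k ^ 2 := by
        by_contra hcon
        exact huT (mem_filter.2 ⟨hu, not_le.1 hcon⟩)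
      have : w u * d u ≤ 1 * (R.card / k ^ 2) :=
        (mul_le_mul_of_nonneg_left hdu (hw0 u)).trans
          (mul_le_mul_of_nonneg_right (hw1 u) hnn)
      linarith
  refine (sum_le_sum h5).trans ?_
  rw [sum_add_distrib, ← sum_filter, filter_mem_eq_inter,
    inter_eq_right.2 (filter_subset _ _ : T ⊆ Q), sum_const, sum_const, nsmul_eq_mul,
    nsmul_eq_mul]
  have h6 : (Q.card : ℝ) * (R.card / k ^ 2) ≤ R.card * (Q.card / k) := by
    rw [show (Q.card : ℝ) * (R.card / k ^ 2) = R.card * (Q.card / k ^ 2) by ring]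
    gcongr
    nlinarith
  calc (T.card : ℝ) * R.card + Q.card * (R.card / k ^ 2)
      ≤ Q.card / k * R.card + R.card * (Q.card / k) := by gcongr
    _ = _ := by ring

/-- More than `k^6` exceptional vertices of one sign would contain a set `R` contradicting
`sum_weighted_le`; the factor `2` accounts for the two signs. -/
lemma card_exceptional_le (hk : 1 ≤ k) (hc : ∀ v u, |c v u| ≤ 1)
    (h : ∀ R ⊆ P, ∀ R' ⊆ Q, R.card = k ^ 6 → R'.card = ⌈(Q.card : ℝ) / k⌉₊ →
      |∑ v ∈ R, ∑ u ∈ R', c v u| ≤ 1 / (k : ℝ) ^ 2 * R.card * R'.card)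
    {w : V' → ℝ} (hw0 : ∀ u, 0 ≤ w u) (hw1 : ∀ u, w u ≤ 1) :
    (P.filter fun v => 2 * Q.card / k < |∑ u ∈ Q, w u * c v u|).card ≤ 2 * k ^ 6 := by
  classical
  have key : ∀ c : V → V' → ℝ, (∀ v u, |c v u| ≤ 1) →
      (∀ R ⊆ P, ∀ R' ⊆ Q, R.card = k ^ 6 → R'.card = ⌈(Q.card : ℝ) / k⌉₊ →
      |∑ v ∈ R, ∑ u ∈ R', c v u| ≤ 1 / (k : ℝ) ^ 2 * R.card * R'.card) →
      (P.filter fun v => 2 * Q.card / k < ∑ u ∈ Q, w u * c v u).card ≤ k ^ 6 := by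
    intro c hc h
    by_contra hcon
    push Not at hcon
    obtain ⟨R, hRs, hRc⟩ := exists_subset_card_eq hcon.le
    have h1 := sum_weighted_le hk hc h hw0 hw1 (hRs.trans (filter_subset _ _)) hRc
    have hne : R.Nonempty := by rw [← card_pos, hRc]; positivity
    have h2 : ∑ v ∈ R, (2 * Q.card / k : ℝ) < ∑ v ∈ R, ∑ u ∈ Q, w u * c v u :=
      sum_lt_sum_of_nonempty hne fun v hv => (mem_filter.1 (hRs hv)).2
    rw [sum_const, nsmul_eq_mul] at h2
    exact absurd h1 (not_le.2 h2)
  have h1 := key c hc h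
  have h2 := key (fun v u => -c v u) (by simpa using hc) (by
    simpa only [sum_neg_distrib, abs_neg] using h)
  have hsub : (P.filter fun v => 2 * Q.card / k < |∑ u ∈ Q, w u * c v u|) ⊆
      (P.filter fun v => 2 * Q.card / k < ∑ u ∈ Q, w u * c v u) ∪
      (P.filter fun v => 2 * Q.card / k < ∑ u ∈ Q, w u * -c v u) := by
    intro v hv
    simp only [mem_union, mem_filter, mul_neg, sum_neg_distrib] at hv ⊢
    rcases lt_abs.1 hv.2 with h | h
    · exact Or.inl ⟨hv.1, h⟩
    · exact Or.inr ⟨hv.1, h⟩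
  calc _ ≤ _ := card_le_card hsub
    _ ≤ _ := card_union_le _ _
    _ ≤ _ := by omega

/-- If the points of `Z` are spread over the vertices in `P`, then the discrepancy between `Z` and
any set `W` of points that lie over `Q` is small. -/
lemma abs_sum_sum_le_of_spread {α : Type*} [DecidableEq V] [DecidableEq V'] (hk : 1 ≤ k)
    (hc : ∀ v u, |c v u| ≤ 1)
    (h : ∀ R ⊆ P, ∀ R' ⊆ Q, R.card = k ^ 6 → R'.card = ⌈(Q.card : ℝ) / k⌉₊ →
      |∑ v ∈ R, ∑ u ∈ R', c v u| ≤ 1 / (k : ℝ) ^ 2 * R.card * R'.card)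
    {p : α → V} {p' : α → V'} {Z W : Finset α} (hZ : ∀ x ∈ Z, p x ∈ P) (hW : ∀ y ∈ W, p' y ∈ Q)
    {F τ : ℝ} (hF : 0 < F) (hWF : ∀ u, ((W.filter fun y => p' y = u).card : ℝ) ≤ F)
    (hsp : ∀ v, ((Z.filter fun x => p x = v).card : ℝ) ≤ τ * Z.card) :
    |∑ x ∈ Z, ∑ y ∈ W, c (p x) (p' y)| ≤
      Z.card * (2 * Q.card / k * F + 2 * k ^ 6 * τ * W.card) := by
  -- The fraction of the cluster `u` that `W` fills, `F` being the cluster size; this turns a set of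
  -- points into a fractional set of vertices.
  set w : V' → ℝ := fun u => (W.filter fun y => p' y = u).card / F with hw
  set E := P.filter fun v => 2 * Q.card / k < |∑ u ∈ Q, w u * c v u| with hE
  have hEc : E.card ≤ 2 * k ^ 6 := card_exceptional_le hk hc h
    (fun u => by positivity) (fun u => (div_le_one hF).2 (hWF u))
  have hsum : ∀ v, ∑ y ∈ W, c v (p' y) = F * ∑ u ∈ Q, w u * c v u := by
    intro v
    rw [← sum_fiberwise_of_maps_to hW, mul_sum]
    refine sum_congr rfl fun u _ => ?_
    rw [sum_congr rfl (g := fun _ => c v u) fun y hy => by rw [(mem_filter.1 hy).2], sum_const,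
      nsmul_eq_mul, hw]
    field_simp
  have h1 : ∀ x ∈ Z, |∑ y ∈ W, c (p x) (p' y)| ≤
      2 * Q.card / k * F + if p x ∈ E then (W.card : ℝ) else 0 := by
    intro x hx
    have hnn : (0 : ℝ) ≤ 2 * Q.card / k * F := by positivity
    split_ifs with hxE
    · have : |∑ y ∈ W, c (p x) (p' y)| ≤ ∑ y ∈ W, (1 : ℝ) :=
        (abs_sum_le_sum_abs _ _).trans (sum_le_sum fun y _ => hc _ _)
      simp only [sum_const, nsmul_eq_mul, mul_one] at this
      linarith
    · have : |∑ u ∈ Q, w u * c (p x) u| ≤ 2 * Q.card / k := by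
        by_contra hcon
        exact hxE (mem_filter.2 ⟨hZ x hx, not_le.1 hcon⟩)
      rw [hsum, abs_mul, abs_of_pos hF, add_zero, mul_comm]
      gcongr
  have h2 : ((Z.filter fun x => p x ∈ E).card : ℝ) ≤ 2 * k ^ 6 * τ * Z.card := by
    have h3 : (Z.filter fun x => p x ∈ E).card = ∑ v ∈ E, (Z.filter fun x => p x = v).card := by
      rw [card_eq_sum_card_fiberwise (s := Z.filter fun x => p x ∈ E) (f := p) (t := E)
        (fun x hx => (mem_filter.1 hx).2)]
      refine sum_congr rfl fun v hv => ?_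
      congr 1
      ext x
      simp only [mem_filter]
      constructor
      · rintro ⟨⟨a, _⟩, b⟩; exact ⟨a, b⟩
      · rintro ⟨a, b⟩; exact ⟨⟨a, b ▸ hv⟩, b⟩
    rcases Z.eq_empty_or_nonempty with rfl | hZne
    · simp
    have hτ : 0 ≤ τ * Z.card := by
      obtain ⟨x, _⟩ := hZne
      exact le_trans (by positivity) (hsp (p x))
    rw [h3]
    push_cast
    calc ∑ v ∈ E, ((Z.filter fun x => p x = v).card : ℝ) ≤ ∑ v ∈ E, τ * Z.card :=
          sum_le_sum fun v _ => hsp v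
      _ = E.card * (τ * Z.card) := by simp
      _ ≤ (2 * k ^ 6 : ℕ) * (τ * Z.card) := by gcongr
      _ = _ := by push_cast; ring
  calc _ ≤ ∑ x ∈ Z, (2 * Q.card / k * F + if p x ∈ E then (W.card : ℝ) else 0) :=
        (abs_sum_le_sum_abs _ _).trans (sum_le_sum h1)
    _ = Z.card * (2 * Q.card / k * F) + (Z.filter fun x => p x ∈ E).card * W.card := by
        rw [sum_add_distrib, ← sum_filter, sum_const, sum_const, nsmul_eq_mul, nsmul_eq_mul]
    _ ≤ Z.card * (2 * Q.card / k * F) + 2 * k ^ 6 * τ * Z.card * W.card := by gcongr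
    _ = _ := by ring

end exceptional

/-! ### Passing to a subset that is concentrated or spread at every level -/

/-- For a refining sequence `p 1, p 2, …` of labellings, a set has a not too small subset on which
the first `t` labellings are constant, and which is spread over the labels of the others. -/
lemma exists_subset_concentrated_spread {α β : Type*} [DecidableEq β] (p : ℕ → α → β)
    (K : ℕ) (hp : ∀ g g', 1 ≤ g → g ≤ g' → g' ≤ K → ∀ x y, p g' x = p g' y → p g x = p g y)
    {τ : ℝ} (hτ0 : 0 < τ) (hτ1 : τ ≤ 1) {Z : Finset α} (hZ : Z.Nonempty) :
    ∃ Z' ⊆ Z, Z'.Nonempty ∧ τ ^ K * Z.card ≤ (Z'.card : ℝ) ∧ ∃ t ≤ K,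
      (∀ g, 1 ≤ g → g ≤ t → ∀ x ∈ Z', ∀ y ∈ Z', p g x = p g y) ∧
      ∀ g, t < g → g ≤ K → ∀ v, ((Z'.filter fun x => p g x = v).card : ℝ) ≤ τ * Z'.card := by
  induction K with
  | zero => exact ⟨Z, Subset.rfl, hZ, by simp, 0, le_rfl, by intros; omega, by intros; omega⟩
  | succ K ih =>
    obtain ⟨Z', hZ', hne, hcard, t, htK, hcon, hspr⟩ :=
      ih fun g g' h1 h2 h3 => hp g g' h1 h2 (h3.trans K.le_succ)
    have hcard' : τ ^ (K + 1) * Z.card ≤ (Z'.card : ℝ) := by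
      refine le_trans ?_ hcard
      exact mul_le_mul_of_nonneg_right (pow_le_pow_of_le_one hτ0.le hτ1 K.le_succ) (by positivity)
    by_cases hall : ∀ v, ((Z'.filter fun x => p (K + 1) x = v).card : ℝ) ≤ τ * Z'.card
    · refine ⟨Z', hZ', hne, hcard', t, by omega, hcon, fun g h1 h2 v => ?_⟩
      rcases h2.lt_or_eq with h2 | rfl
      · exact hspr g h1 (by omega) v
      · exact hall v
    · push Not at hall
      obtain ⟨v, hv⟩ := hall
      -- A set already spread over the coarser labels of level `K` cannot have a heavy label at
      -- level `K + 1`. So a heavy label forces `t = K`, and restricting to it costs one factor `τ`.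
      rcases htK.lt_or_eq with htK | rfl
      · exfalso
        have hne' : (Z'.filter fun x => p (K + 1) x = v).Nonempty := by
          rw [← card_pos]
          have : (0 : ℝ) < (Z'.filter fun x => p (K + 1) x = v).card :=
            lt_of_le_of_lt (by positivity) hv
          exact_mod_cast this
        obtain ⟨x₀, hx₀⟩ := hne'
        have hx₀' := (mem_filter.1 hx₀).2
        have h3 := hspr K htK le_rfl (p K x₀)
        have h4 : (Z'.filter fun x => p (K + 1) x = v) ⊆ Z'.filter fun x => p K x = p K x₀ := by
          intro x hx
          rw [mem_filter] at hx ⊢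
          exact ⟨hx.1, hp K (K + 1) (by omega) (by omega) le_rfl _ _ (hx.2.trans hx₀'.symm)⟩
        have h5 : ((Z'.filter fun x => p (K + 1) x = v).card : ℝ) ≤
            (Z'.filter fun x => p K x = p K x₀).card := by exact_mod_cast card_le_card h4
        linarith
      · refine ⟨Z'.filter fun x => p (t + 1) x = v, (filter_subset _ _).trans hZ', ?_, ?_, t + 1,
          le_rfl, ?_, by intros; omega⟩
        · rw [← card_pos]
          have : (0 : ℝ) < (Z'.filter fun x => p (t + 1) x = v).card :=
            lt_of_le_of_lt (by positivity) hv
          exact_mod_cast this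
        · refine le_trans ?_ hv.le
          rw [pow_succ', mul_assoc]
          gcongr
        · intro g h1 h2 x hx y hy
          rw [mem_filter] at hx hy
          exact hp g (t + 1) h1 h2 le_rfl _ _ (hx.2.trans hy.2.symm)

/-! ### Comparing the density functions of two sets -/

lemma sum_Ioc_inv_four_pow_le (t N : ℕ) : ∑ g ∈ Ioc t N, ((4 : ℝ) ^ g)⁻¹ ≤ ((4 : ℝ) ^ t)⁻¹ / 3 := by
  rcases le_or_gt t N with h | h
  · have key : ∑ g ∈ Ioc t N, ((4 : ℝ) ^ g)⁻¹ = ((4 : ℝ) ^ t)⁻¹ / 3 - ((4 : ℝ) ^ N)⁻¹ / 3 := by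
      induction N, h using Nat.le_induction with
      | base => simp
      | succ N h ih =>
        rw [← Finset.insert_Ioc_right_eq_Ioc_add_one h, sum_insert (by simp), ih, pow_succ]
        field_simp
        ring
    rw [key]
    have : (0 : ℝ) < ((4 : ℝ) ^ N)⁻¹ := by positivity
    linarith
  · rw [Ioc_eq_empty (by omega), sum_empty]
    positivity

/-- The sum is an integer multiple of `4^(-t)`. -/
lemma sum_Icc_inv_four_pow_eq_zero {t : ℕ} {a b : ℕ → ℝ}
    (ha : ∀ g, 1 ≤ g → g ≤ t → a g = 0 ∨ a g = 1) (hb : ∀ g, 1 ≤ g → g ≤ t → b g = 0 ∨ b g = 1)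
    (h : |∑ g ∈ Icc 1 t, ((4 : ℝ) ^ g)⁻¹ * (a g - b g)| < ((4 : ℝ) ^ t)⁻¹) :
    ∑ g ∈ Icc 1 t, ((4 : ℝ) ^ g)⁻¹ * (a g - b g) = 0 := by
  have key : ∃ z : ℤ, ∑ g ∈ Icc 1 t, ((4 : ℝ) ^ g)⁻¹ * (a g - b g) = z * ((4 : ℝ) ^ t)⁻¹ := by
    clear h
    induction t with
    | zero => exact ⟨0, by simp⟩
    | succ t ih =>
      obtain ⟨z, hz⟩ := ih (fun g h1 h2 => ha g h1 (by omega)) (fun g h1 h2 => hb g h1 (by omega))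
      obtain ⟨c, hc⟩ : ∃ c : ℤ, a (t + 1) - b (t + 1) = c := by
        rcases ha (t + 1) (by omega) le_rfl with h1 | h1 <;>
          rcases hb (t + 1) (by omega) le_rfl with h2 | h2
        exacts [⟨0, by simp [h1, h2]⟩, ⟨-1, by simp [h1, h2]⟩, ⟨1, by simp [h1, h2]⟩,
          ⟨0, by simp [h1, h2]⟩]
      refine ⟨4 * z + c, ?_⟩
      rw [sum_Icc_succ_top (by omega), hz, hc, pow_succ]
      push_cast
      field_simp
  obtain ⟨z, hz⟩ := key
  have hpos : (0 : ℝ) < ((4 : ℝ) ^ t)⁻¹ := by positivity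
  rw [hz, abs_mul, abs_of_pos hpos] at h
  have h1 : |(z : ℝ)| < 1 := by
    by_contra hcon
    push Not at hcon
    nlinarith
  have h2 : z = 0 := by
    have : |z| < 1 := by exact_mod_cast h1
    exact Int.abs_lt_one_iff.1 this
  rw [hz, h2]
  simp

section density

variable {α : Type*} {x κ θ : ℝ} {t N : ℕ} {a b : ℕ → α → ℝ}

/-- If the functions `a g` have mean about one half, `b (t + 1)` vanishes, then the weighted sums of
the functions `a g` and `b g` cannot agree. -/
lemma not_close_of_vanishing {W : Finset α} (htN : t < N) (hW : W.Nonempty)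
    (hxW : x ≤ 12 * W.card) (hκ0 : 0 ≤ κ) (hκ : κ ≤ 1 / 64) (hθ : 50 * θ ≤ ((4 : ℝ) ^ (t + 1))⁻¹)
    (ha : ∀ g, t < g → g ≤ N → |∑ y ∈ W, (a g y - 1 / 2)| ≤ κ * x)
    (hb1 : ∀ g y, b g y ≤ 1) (hb : ∀ y ∈ W, b (t + 1) y = 0)
    (hab : ∀ y ∈ W, |∑ g ∈ Ioc t N, ((4 : ℝ) ^ g)⁻¹ * (a g y - b g y)| ≤ θ) : False := by
  have hWpos : (0 : ℝ) < W.card := by exact_mod_cast hW.card_pos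
  have hup : ∑ y ∈ W, ∑ g ∈ Ioc t N, ((4 : ℝ) ^ g)⁻¹ * (a g y - b g y) ≤ W.card * θ := by
    calc _ ≤ ∑ y ∈ W, θ := sum_le_sum fun y hy => (abs_le.1 (hab y hy)).2
      _ = _ := by simp
  rw [sum_comm] at hup
  simp_rw [← mul_sum] at hup
  have ha' : ∀ g, t < g → g ≤ N → W.card / 2 - κ * x ≤ ∑ y ∈ W, a g y := by
    intro g h1 h2
    have := (abs_le.1 (ha g h1 h2)).1
    rw [sum_sub_distrib, sum_const, nsmul_eq_mul] at this
    linarith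
  set u := ((4 : ℝ) ^ (t + 1))⁻¹ with hu
  have hupos : 0 < u := by positivity
  rw [← insert_Ioc_add_one_left_eq_Ioc htN, sum_insert (by simp)] at hup
  have h1 : u * (W.card / 2 - κ * x) ≤ u * ∑ y ∈ W, (a (t + 1) y - b (t + 1) y) := by
    gcongr
    rw [sum_sub_distrib, sum_eq_zero hb, sub_zero]
    exact ha' _ (by omega) (by omega)
  have h2 : ∀ g ∈ Ioc (t + 1) N, ((4 : ℝ) ^ g)⁻¹ * -(W.card / 2 + κ * x) ≤
      ((4 : ℝ) ^ g)⁻¹ * ∑ y ∈ W, (a g y - b g y) := by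
    intro g hg
    rw [mem_Ioc] at hg
    gcongr
    have h3 : ∑ y ∈ W, b g y ≤ W.card := by
      calc _ ≤ ∑ y ∈ W, (1 : ℝ) := sum_le_sum fun y _ => hb1 g y
        _ = _ := by simp
    have := ha' g (by omega) hg.2
    rw [sum_sub_distrib]
    linarith
  have h3 := sum_le_sum h2
  rw [← sum_mul] at h3
  have h4 := sum_Ioc_inv_four_pow_le (t + 1) N
  rw [← hu] at h4
  -- With `u = 4^(-(t+1))`, level `t + 1` gives at least `u(|W|/2 - κx)` and the later levels lose
  -- at most `(u/3)(|W|/2 + κx)`. As `κx ≤ (12/64)|W|`, at least `u|W|/12` remains, against the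
  -- upper bound `θ|W| ≤ u|W|/50`.
  have hκx : κ * x ≤ W.card * (12 / 64) := by nlinarith
  have h5 : 0 ≤ W.card / 2 + κ * x := by
    have := (abs_nonneg _).trans (ha (t + 1) (by omega) (by omega))
    linarith
  have h6 : u / 3 * -(W.card / 2 + κ * x) ≤
      (∑ g ∈ Ioc (t + 1) N, ((4 : ℝ) ^ g)⁻¹) * -(W.card / 2 + κ * x) := by nlinarith
  have h7 : u * (κ * x) ≤ u * (W.card * (12 / 64)) := by gcongr
  have h8 : 0 < u * W.card := by positivity
  have h9 : 50 * (W.card * θ) ≤ W.card * u := by nlinarith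
  nlinarith

/-- One of the values `0`, `1` of `b (t + 1)` is taken on at least half of `W`. The value `1`
reduces to `0` by passing to `1 - a` and `1 - b`, which preserves deviations from `1/2` up to sign.
-/
lemma not_close_of_concentrated {W : Finset α} (htN : t < N) (hx : 0 < x)
    (hxW : x ≤ 6 * W.card) (hκ0 : 0 ≤ κ) (hκ : κ ≤ 1 / 64) (hθ : 50 * θ ≤ ((4 : ℝ) ^ (t + 1))⁻¹)
    (ha : ∀ g, t < g → g ≤ N → ∀ W' ⊆ W, |∑ y ∈ W', (a g y - 1 / 2)| ≤ κ * x)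
    (hb0 : ∀ g y, 0 ≤ b g y) (hb1 : ∀ g y, b g y ≤ 1)
    (hb : ∀ y ∈ W, b (t + 1) y = 0 ∨ b (t + 1) y = 1)
    (hab : ∀ y ∈ W, |∑ g ∈ Ioc t N, ((4 : ℝ) ^ g)⁻¹ * (a g y - b g y)| ≤ θ) : False := by
  classical
  set W0 := W.filter fun y => b (t + 1) y = 0
  set W1 := W.filter fun y => ¬ b (t + 1) y = 0
  have hsum : (W0.card : ℝ) + W1.card = W.card := by
    exact_mod_cast card_filter_add_card_filter_not (s := W) (fun y => b (t + 1) y = 0)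
  have hne : ∀ V : Finset α, x ≤ 12 * V.card → V.Nonempty := fun V hV => by
    rw [← card_pos]
    have : (0 : ℝ) < V.card := by linarith
    exact_mod_cast this
  rcases le_or_gt x (12 * W0.card) with h | h
  · exact not_close_of_vanishing htN (hne _ h) h hκ0 hκ hθ
      (fun g h1 h2 => ha g h1 h2 _ (filter_subset _ _)) hb1 (fun y hy => (mem_filter.1 hy).2)
      (fun y hy => hab y (mem_filter.1 hy).1)
  · have h' : x ≤ 12 * W1.card := by linarith
    refine not_close_of_vanishing (a := fun g y => 1 - a g y) (b := fun g y => 1 - b g y)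
      htN (hne _ h') h' hκ0 hκ hθ ?_ (fun g y => by linarith [hb0 g y]) ?_ ?_
    · intro g h1 h2
      rw [← abs_neg, ← sum_neg_distrib]
      convert ha g h1 h2 W1 (filter_subset _ _) using 3
      ring
    · intro y hy
      obtain ⟨h1, h2⟩ := mem_filter.1 hy
      rw [(hb y h1).resolve_left h2, sub_self]
    · intro y hy
      rw [← abs_neg, ← sum_neg_distrib]
      convert hab y (mem_filter.1 hy).1 using 3
      ring

/-- A function all of whose partial sums are small is small at most points. -/
lemma card_filter_abs_gt_le {W : Finset α} {D : α → ℝ} {s δ : ℝ} (hδ : 0 < δ)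
    (h : ∀ W' ⊆ W, |∑ y ∈ W', D y| ≤ s) :
    ((W.filter fun y => ¬ |D y| ≤ δ).card : ℝ) * δ ≤ 2 * s := by
  classical
  have h1 : ((W.filter fun y => δ < D y).card : ℝ) * δ ≤ s := by
    calc _ = ∑ y ∈ W.filter (fun y => δ < D y), δ := by simp
      _ ≤ ∑ y ∈ W.filter (fun y => δ < D y), D y :=
        sum_le_sum fun y hy => (mem_filter.1 hy).2.le
      _ ≤ s := (abs_le.1 (h _ (filter_subset _ _))).2
  have h2 : ((W.filter fun y => D y < -δ).card : ℝ) * δ ≤ s := by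
    calc _ = -∑ y ∈ W.filter (fun y => D y < -δ), -δ := by simp
      _ ≤ -∑ y ∈ W.filter (fun y => D y < -δ), D y :=
        neg_le_neg (sum_le_sum fun y hy => (mem_filter.1 hy).2.le)
      _ ≤ s := by linarith [(abs_le.1 (h _ (filter_subset (fun y => D y < -δ) W))).1]
  have h3 : (W.filter fun y => ¬ |D y| ≤ δ) ⊆
      (W.filter fun y => δ < D y) ∪ (W.filter fun y => D y < -δ) := by
    intro y hy
    simp only [mem_union, mem_filter, abs_le, not_and_or, not_le] at hy ⊢
    tauto
  have h4 : ((W.filter fun y => ¬ |D y| ≤ δ).card : ℝ) ≤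
      (W.filter fun y => δ < D y).card + (W.filter fun y => D y < -δ).card := by
    exact_mod_cast (card_le_card h3).trans (card_union_le _ _)
  nlinarith

lemma abs_sum_Ioc_le (ha0 : ∀ g y, 0 ≤ a g y) (ha1 : ∀ g y, a g y ≤ 1) (hb0 : ∀ g y, 0 ≤ b g y)
    (hb1 : ∀ g y, b g y ≤ 1) (y : α) :
    |∑ g ∈ Ioc t N, ((4 : ℝ) ^ g)⁻¹ * (a g y - b g y)| ≤ ((4 : ℝ) ^ t)⁻¹ / 3 := by
  refine (abs_sum_le_sum_abs _ _).trans (le_trans ?_ (sum_Ioc_inv_four_pow_le t N))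
  refine sum_le_sum fun g _ => ?_
  have hpos : (0 : ℝ) < ((4 : ℝ) ^ g)⁻¹ := by positivity
  rw [abs_mul, abs_of_pos hpos]
  have : |a g y - b g y| ≤ 1 :=
    abs_le.2 ⟨by linarith [ha0 g y, hb1 g y], by linarith [ha1 g y, hb0 g y]⟩
  nlinarith

/-- The weighted degrees into two sets differ by `G + ∑ 4 ^ (-g) (a g - b g)`. If `a g` and `b g`
are `0` or `1` up to some level and have mean about one half above it, then this function cannot
have small partial sums. -/
theorem false_of_small_partial_sums {X W : Finset α} {H : α → Prop} {G : α → ℝ}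
    {tA tB : ℕ} {η γ : ℝ} (hX : X.Nonempty) (hWX : W ⊆ X) (hXW : (X.card : ℝ) ≤ 5 * W.card)
    (hη : 0 < η) (hγη : 10000 * γ ≤ η) (hηt : ∀ t ≤ N, 100 * η ≤ ((4 : ℝ) ^ t)⁻¹)
    (hκ0 : 0 ≤ κ) (hκ : κ ≤ 1 / 64) (hκη : κ ≤ η / 64)
    (ha0 : ∀ g y, 0 ≤ a g y) (ha1 : ∀ g y, a g y ≤ 1) (hb0 : ∀ g y, 0 ≤ b g y)
    (hb1 : ∀ g y, b g y ≤ 1) (htA : tA ≤ N) (htB : tB ≤ N)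
    (ha : ∀ g, 1 ≤ g → g ≤ tA → ∀ y ∈ X, a g y = 0 ∨ a g y = 1)
    (hb : ∀ g, 1 ≤ g → g ≤ tB → ∀ y ∈ X, b g y = 0 ∨ b g y = 1)
    (ha' : ∀ g, tA < g → g ≤ N → ∀ W' ⊆ X, |∑ y ∈ W', (a g y - 1 / 2)| ≤ κ * X.card)
    (hb' : ∀ g, tB < g → g ≤ N → ∀ W' ⊆ X, |∑ y ∈ W', (b g y - 1 / 2)| ≤ κ * X.card)
    (hG1 : ∀ y ∈ X, H y → 2 / 3 * η ≤ G y ∧ G y ≤ 4 / 3 * η)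
    (hG2 : ∀ y ∈ X, ¬ H y → -(4 / 3 * η) ≤ G y ∧ G y ≤ -(2 / 3 * η))
    (hD : ∀ W' ⊆ W, |∑ y ∈ W', (G y + ∑ g ∈ Icc 1 N, ((4 : ℝ) ^ g)⁻¹ * (a g y - b g y))| ≤
      3 * γ * X.card) : False := by
  classical
  set D : α → ℝ := fun y => G y + ∑ g ∈ Icc 1 N, ((4 : ℝ) ^ g)⁻¹ * (a g y - b g y) with hDdef
  have hXpos : (0 : ℝ) < X.card := by exact_mod_cast hX.card_pos
  -- At most `|X|/100` points are discarded, since `2 · 3γ|X|` is far below `(η/12)|X|/100`; from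
  -- `|W| ≥ |X|/5` there remains `|V| ≥ |X|/6`.
  set V := W.filter fun y => |D y| ≤ η / 12 with hV
  have hVX : V ⊆ X := (filter_subset _ _).trans hWX
  have hVc : (X.card : ℝ) ≤ 6 * V.card := by
    have h1 := card_filter_abs_gt_le (D := D) (show 0 < η / 12 by positivity) hD
    have h2 : (V.card : ℝ) + (W.filter fun y => ¬ |D y| ≤ η / 12).card = W.card := by
      exact_mod_cast card_filter_add_card_filter_not (s := W) (fun y => |D y| ≤ η / 12)
    have h3 : γ * X.card ≤ η / 10000 * X.card := by gcongr; linarith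
    have h4 : ((W.filter fun y => ¬ |D y| ≤ η / 12).card : ℝ) ≤ X.card / 100 := by
      by_contra hcon
      have h5 := mul_lt_mul_of_pos_right (not_le.1 hcon) (show 0 < η / 12 by positivity)
      have h6 : 0 < η * X.card := by positivity
      linarith
    linarith
  have hGabs : ∀ y ∈ X, |G y| ≤ 4 / 3 * η := by
    intro y hy
    rw [abs_le]
    by_cases hH : H y
    · obtain ⟨h1, h2⟩ := hG1 y hy hH
      constructor <;> linarith
    · obtain ⟨h1, h2⟩ := hG2 y hy hH
      constructor <;> linarith
  have hsplit : ∀ t ≤ N, t ≤ tA → t ≤ tB → ∀ y ∈ V,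
      D y = G y + ∑ g ∈ Ioc t N, ((4 : ℝ) ^ g)⁻¹ * (a g y - b g y) := by
    intro t htN h1 h2 y hy
    have hyX := hVX hy
    have hu : ∑ g ∈ Icc 1 N, ((4 : ℝ) ^ g)⁻¹ * (a g y - b g y) =
        ∑ g ∈ Icc 1 t, ((4 : ℝ) ^ g)⁻¹ * (a g y - b g y) +
          ∑ g ∈ Ioc t N, ((4 : ℝ) ^ g)⁻¹ * (a g y - b g y) := by
      rw [← sum_union (disjoint_left.2 fun g h3 h4 => by rw [mem_Icc] at h3; rw [mem_Ioc] at h4; omega)]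
      refine sum_congr ?_ fun _ _ => rfl
      ext g
      simp only [mem_Icc, mem_union, mem_Ioc]
      omega
    have hDy := (mem_filter.1 hy).2
    -- The sum over the first `t` levels is at most `η/12 + 4η/3 + 4^(-t)/3` in absolute value,
    -- which is below `4^(-t)`.
    have hzero := sum_Icc_inv_four_pow_eq_zero (t := t) (a := fun g => a g y) (b := fun g => b g y)
      (fun g h3 h4 => ha g h3 (by omega) y hyX) (fun g h3 h4 => hb g h3 (by omega) y hyX) (by
        have h3 := abs_le.1 (abs_sum_Ioc_le (t := t) (N := N) ha0 ha1 hb0 hb1 y)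
        have h4 := abs_le.1 (hGabs y hyX)
        have h5 := hηt t htN
        simp only [hDdef, hu] at hDy
        rw [abs_le] at hDy
        rw [abs_lt]
        constructor <;> linarith)
    simp only [hDdef, hu, hzero, zero_add]
  have hclose : ∀ t ≤ N, t ≤ tA → t ≤ tB → ∀ y ∈ V,
      |∑ g ∈ Ioc t N, ((4 : ℝ) ^ g)⁻¹ * (a g y - b g y)| ≤ 2 * η := by
    intro t htN h1 h2 y hy
    have h3 := hsplit t htN h1 h2 y hy
    have h4 := abs_le.1 (hGabs y (hVX hy))
    have h5 := abs_le.1 (mem_filter.1 hy).2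
    rw [abs_le]
    constructor <;> linarith
  rcases lt_trichotomy tA tB with hlt | rfl | hlt
  -- At level `tA + 1` the function `b` is still `0` or `1` while `a` already has mean about `1/2`.
  · refine not_close_of_concentrated (t := tA) (hlt.trans_le htB) hXpos hVc hκ0 hκ (θ := 2 * η)
      (by linarith [hηt (tA + 1) (by omega)]) (fun g h1 h2 W' hW' => ha' g h1 h2 W' (hW'.trans hVX))
      hb0 hb1 (fun y hy => hb _ (by omega) (by omega) y (hVX hy)) (hclose tA htA le_rfl hlt.le)
  -- Equal thresholds: all concentrated levels vanish and at every remaining level both functions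
  -- have mean about `1/2`, so the traps contribute almost nothing on average.
  · have hsmall : ∀ W' ⊆ V, |∑ y ∈ W', (D y - G y)| ≤ κ * X.card := by
      intro W' hW'
      have h1 : ∑ y ∈ W', (D y - G y) = ∑ g ∈ Ioc tA N, ((4 : ℝ) ^ g)⁻¹ *
          (∑ y ∈ W', (a g y - 1 / 2) - ∑ y ∈ W', (b g y - 1 / 2)) := by
        have : ∀ g, ((4 : ℝ) ^ g)⁻¹ *
            (∑ y ∈ W', (a g y - 1 / 2) - ∑ y ∈ W', (b g y - 1 / 2)) =
            ∑ y ∈ W', ((4 : ℝ) ^ g)⁻¹ * (a g y - b g y) := by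
          intro g
          rw [← sum_sub_distrib, mul_sum]
          exact sum_congr rfl fun y _ => by ring
        simp_rw [this]
        rw [sum_comm]
        refine sum_congr rfl fun y hy => ?_
        rw [hsplit tA htA le_rfl le_rfl y (hW' hy)]
        ring
      rw [h1]
      have h2 : ∀ g ∈ Ioc tA N, |((4 : ℝ) ^ g)⁻¹ *
          (∑ y ∈ W', (a g y - 1 / 2) - ∑ y ∈ W', (b g y - 1 / 2))| ≤
          ((4 : ℝ) ^ g)⁻¹ * (2 * (κ * X.card)) := by
        intro g hg
        rw [mem_Ioc] at hg
        rw [abs_mul, abs_of_pos (by positivity : (0 : ℝ) < ((4 : ℝ) ^ g)⁻¹)]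
        gcongr
        have h3 := abs_le.1 (ha' g hg.1 hg.2 W' (hW'.trans hVX))
        have h4 := abs_le.1 (hb' g hg.1 hg.2 W' (hW'.trans hVX))
        rw [abs_le]
        constructor <;> linarith
      refine (abs_sum_le_sum_abs _ _).trans ((sum_le_sum h2).trans ?_)
      rw [← sum_mul]
      have h3 : ∑ g ∈ Ioc tA N, ((4 : ℝ) ^ g)⁻¹ ≤ 1 / 3 := by
        refine (sum_Ioc_inv_four_pow_le tA N).trans ?_
        have : ((4 : ℝ) ^ tA)⁻¹ ≤ 1 := inv_le_one_of_one_le₀ (one_le_pow₀ (by norm_num))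
        linarith
      have h4 : 0 ≤ κ * X.card := by positivity
      nlinarith
    -- On a set where `G` has constant sign, `D - G` keeps the opposite sign and size at least `2η/3
    -- - η/12`. On at least `|X|/12` points this exceeds what `hsmall` allows. One of the two sign
    -- classes of `V` is that large.
    have hcontra : ∀ (W' : Finset α) (σ : ℝ), W' ⊆ V → (σ = 1 ∨ σ = -1) →
        (∀ y ∈ W', 2 / 3 * η ≤ σ * G y) → (X.card : ℝ) ≤ 12 * W'.card → False := by
      intro W' σ hW' hσ hG hc
      have h1 := hsmall W' hW'
      have h2 : ∑ y ∈ W', (2 / 3 * η - η / 12) ≤ |∑ y ∈ W', (D y - G y)| := by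
        have h3 : ∑ y ∈ W', (2 / 3 * η - η / 12) ≤ ∑ y ∈ W', -σ * (D y - G y) := by
          refine sum_le_sum fun y hy => ?_
          have h4 := abs_le.1 (mem_filter.1 (hW' hy)).2
          have h5 := hG y hy
          rcases hσ with rfl | rfl <;> linarith
        rw [← mul_sum] at h3
        refine h3.trans ((le_abs_self _).trans ?_)
        rw [abs_mul]
        rcases hσ with rfl | rfl <;> simp
      rw [sum_const, nsmul_eq_mul] at h2
      have h3 : κ * X.card ≤ η / 64 * (12 * W'.card) := by gcongr
      have h4 : 0 < (W'.card : ℝ) * η := by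
        have : (0 : ℝ) < W'.card := by linarith
        positivity
      nlinarith
    have hsum : ((V.filter fun y => H y).card : ℝ) + (V.filter fun y => ¬ H y).card = V.card := by
      exact_mod_cast card_filter_add_card_filter_not (s := V) (fun y => H y)
    rcases le_or_gt (X.card : ℝ) (12 * (V.filter fun y => H y).card) with h | h
    · refine hcontra _ 1 (filter_subset _ _) (Or.inl rfl) (fun y hy => ?_) h
      obtain ⟨h1, h2⟩ := mem_filter.1 hy
      linarith [(hG1 y (hVX h1) h2).1]
    · refine hcontra (V.filter fun y => ¬ H y) (-1) (filter_subset _ _) (Or.inr rfl)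
        (fun y hy => ?_) (by linarith)
      obtain ⟨h1, h2⟩ := mem_filter.1 hy
      linarith [(hG2 y (hVX h1) h2).2]
  · refine not_close_of_concentrated (t := tB) (a := b) (b := a) (hlt.trans_le htA) hXpos hVc hκ0 hκ
      (θ := 2 * η) (by linarith [hηt (tB + 1) (by omega)])
      (fun g h1 h2 W' hW' => hb' g h1 h2 W' (hW'.trans hVX))
      ha0 ha1 (fun y hy => ha _ (by omega) (by omega) y (hVX hy)) (fun y hy => ?_)
    rw [← abs_neg, ← sum_neg_distrib]
    convert hclose tB htB hlt.le le_rfl y hy using 3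
    ring

end density

/-! ### Clusters -/

lemma mem_cluster {n r : ℕ} {i : Fin (order r)} {x : Fin n} :
    x ∈ cluster n r i ↔ (x : ℕ) / (n / order r) = i := by
  simp [cluster]

/-- The canonical partitions are nested: the label at a coarse level is a function of the label at a
finer one. -/
lemma div_cluster_size {a b n : ℕ} (hab : a ≤ b) (hb : order b ∣ n) (x : ℕ) :
    x / (n / order a) = x / (n / order b) / (order b / order a) := by
  obtain ⟨c, hc⟩ := order_dvd_order hab
  obtain ⟨d, rfl⟩ := hb
  rw [Nat.div_div_eq_div_mul, Nat.mul_div_cancel_left _ (order_pos b), hc,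
    Nat.mul_div_cancel_left _ (order_pos a), mul_assoc, Nat.mul_div_cancel_left _ (order_pos a),
    mul_comm d]

lemma div_cluster_size_lt {n r : ℕ} (h : order r ∣ n) (x : Fin n) :
    (x : ℕ) / (n / order r) < order r := by
  apply Nat.div_lt_of_lt_mul
  rw [Nat.div_mul_cancel h]
  exact x.2

/-- The index of the cluster of `P_r` that contains `x`. -/
def label {n r : ℕ} (h : order r ∣ n) (x : Fin n) : Fin (order r) :=
  ⟨(x : ℕ) / (n / order r), div_cluster_size_lt h x⟩

lemma mem_cluster_iff_label {n r : ℕ} (h : order r ∣ n) {i : Fin (order r)} {x : Fin n} :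
    x ∈ cluster n r i ↔ label h x = i := by
  rw [mem_cluster, Fin.ext_iff]; rfl

lemma label_mem_cluster {n a b : ℕ} (hab : a ≤ b) (hb : order b ∣ n) {i : Fin (order a)}
    {x : Fin n} (hx : x ∈ cluster n a i) : label hb x ∈ cluster (order b) a i := by
  rw [mem_cluster] at hx ⊢
  rw [← hx, div_cluster_size hab hb]
  rfl

lemma label_eq_of_mem_cluster {n a b : ℕ} (hab : a ≤ b) (hb : order b ∣ n) {i : Fin (order b)}
    {x y : Fin n} (hx : x ∈ cluster n b i) (hy : y ∈ cluster n b i) :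
    (x : ℕ) / (n / order a) = (y : ℕ) / (n / order a) := by
  rw [mem_cluster] at hx hy
  rw [div_cluster_size hab hb, div_cluster_size hab hb, hx, hy]

lemma card_cluster {n r : ℕ} (h : order r ∣ n) (i : Fin (order r)) :
    (cluster n r i).card = n / order r := by
  rcases Nat.eq_zero_or_pos n with rfl | hn
  · simp [cluster]
  have hd : 0 < n / order r := Nat.div_pos (Nat.le_of_dvd hn h) (order_pos r)
  set d := n / order r with hd'
  have hnd : order r * d = n := Nat.mul_div_cancel' h
  have : (cluster n r i).map Fin.valEmbedding = Ico (i * d) (i * d + d) := by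
    ext x
    simp only [mem_map, mem_cluster, ← hd', Fin.valEmbedding_apply, mem_Ico]
    constructor
    · rintro ⟨y, hy, rfl⟩
      rw [← hy]
      have h1 := Nat.div_add_mod (y : ℕ) d
      have h2 := Nat.mod_lt (y : ℕ) hd
      rw [mul_comm] at h1
      omega
    · rintro ⟨h1, h2⟩
      have h3 : ((i : ℕ) + 1) * d ≤ order r * d := Nat.mul_le_mul_right _ i.2
      rw [hnd, add_mul, one_mul] at h3
      refine ⟨⟨x, by omega⟩, ?_, rfl⟩
      apply Nat.div_eq_of_lt_le h1
      rw [add_mul, one_mul]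
      exact h2
  rw [← card_map, this]
  simp

lemma cluster_disjoint {n r : ℕ} {i j : Fin (order r)} {x : Fin n} (hi : x ∈ cluster n r i)
    (hj : x ∈ cluster n r j) : i = j := by
  rw [mem_cluster] at hi hj
  exact Fin.ext (hi.symm.trans hj)

/-! ### The weights of `G`, level by level -/

namespace Choices

variable {ε : ℝ} (C : Choices ε) {n r : ℕ}

lemma mem_biUnion_subcluster {i : Fin (order r)} {T : Finset (Fin (phi (order r)))} {x : Fin n} :
    x ∈ T.biUnion (subcluster n r i) ↔
      ∃ t ∈ T, (x : ℕ) / (n / order (r + 1)) = t + phi (order r) * i := by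
  simp only [mem_biUnion, subcluster]
  refine exists_congr fun t => and_congr_right fun _ => ?_
  exact mem_cluster

lemma div_eq_of_mem_biUnion_subcluster (h : order (r + 1) ∣ n) {i : Fin (order r)}
    {T : Finset (Fin (phi (order r)))} {x : Fin n} (hx : x ∈ T.biUnion (subcluster n r i)) :
    x ∈ cluster n r i := by
  obtain ⟨t, _, ht⟩ := mem_biUnion_subcluster.1 hx
  rw [mem_cluster, div_cluster_size r.le_succ h, ht]
  have h1 : order (r + 1) / order r = phi (order r) := by
    rw [order, Nat.mul_div_cancel_left _ (order_pos r)]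
  rw [h1, Nat.add_mul_div_left _ _ (by unfold phi; positivity), Nat.div_eq_of_lt t.2, zero_add]

lemma setA_subset (h : order (r + 1) ∣ n) (i j : Fin (order r)) :
    C.setA n r i j ⊆ cluster n r i := fun _ => div_eq_of_mem_biUnion_subcluster h

lemma setB_subset (h : order (r + 1) ∣ n) (i j : Fin (order r)) :
    C.setB n r i j ⊆ cluster n r i := fun _ => div_eq_of_mem_biUnion_subcluster h

lemma mem_setB_iff (h : order (r + 1) ∣ n) {i j : Fin (order r)} {x : Fin n}
    (hx : x ∈ cluster n r i) : x ∈ C.setB n r i j ↔ x ∉ C.setA n r i j := by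
  unfold setA setB
  rw [mem_biUnion_subcluster, mem_biUnion_subcluster]
  constructor
  · rintro ⟨t, ht, h1⟩ ⟨t', ht', h2⟩
    have : t = t' := Fin.ext (by omega)
    exact (mem_compl.1 ht) (this ▸ ht')
  · intro hA
    have hpos : 0 < phi (order r) := by unfold phi; positivity
    set z := (x : ℕ) / (n / order (r + 1)) with hz
    have h1 : z / phi (order r) = i := by
      rw [mem_cluster, div_cluster_size r.le_succ h] at hx
      rwa [order, Nat.mul_div_cancel_left _ (order_pos r)] at hx
    have h2 : z = z % phi (order r) + phi (order r) * i := by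
      rw [← h1, Nat.mod_add_div]
    refine ⟨⟨z % phi (order r), Nat.mod_lt _ hpos⟩, ?_, h2⟩
    rw [mem_compl]
    intro hmem
    exact hA ⟨_, hmem, h2⟩

/-- The pairs that receive weight at level `r + 1`. -/
def LevelAdj (n r : ℕ) (x y : Fin n) : Prop :=
  ∃ i j : Fin (order r),
    (x ∈ C.setA n r i j ∧ y ∈ C.setA n r j i) ∨ (x ∈ C.setB n r i j ∧ y ∈ C.setB n r j i)

lemma levelAdj_congr {x x' : Fin n}
    (hx : (x : ℕ) / (n / order (r + 1)) = (x' : ℕ) / (n / order (r + 1))) (y : Fin n) :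
    C.LevelAdj n r x y ↔ C.LevelAdj n r x' y := by
  unfold LevelAdj setA setB
  simp only [mem_biUnion_subcluster, hx]

lemma levelAdj_of_setA {i j : Fin (order r)} {x y : Fin n} (hx : x ∈ C.setA n r i j)
    (hy : y ∈ C.setA n r j i) : C.LevelAdj n r x y := ⟨i, j, Or.inl ⟨hx, hy⟩⟩

lemma levelAdj_of_setB {i j : Fin (order r)} {x y : Fin n} (hx : x ∈ C.setB n r i j)
    (hy : y ∈ C.setB n r j i) : C.LevelAdj n r x y := ⟨i, j, Or.inr ⟨hx, hy⟩⟩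

/-- The clusters of `x` and `y` determine the indices, and `A`, `B` are complementary in each
cluster. -/
lemma levelAdj_iff (h : order (r + 1) ∣ n) {i j : Fin (order r)} {x y : Fin n}
    (hx : x ∈ cluster n r i) (hy : y ∈ cluster n r j) :
    C.LevelAdj n r x y ↔ (x ∈ C.setA n r i j ↔ y ∈ C.setA n r j i) := by
  constructor
  · rintro ⟨i', j', h'⟩
    obtain ⟨rfl, rfl⟩ : i' = i ∧ j' = j := by
      rcases h' with h' | h'
      · exact ⟨cluster_disjoint (C.setA_subset h _ _ h'.1) hx,
          cluster_disjoint (C.setA_subset h _ _ h'.2) hy⟩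
      · exact ⟨cluster_disjoint (C.setB_subset h _ _ h'.1) hx,
          cluster_disjoint (C.setB_subset h _ _ h'.2) hy⟩
    rw [C.mem_setB_iff h hx, C.mem_setB_iff h hy] at h'
    tauto
  · intro h'
    by_cases hxA : x ∈ C.setA n r i j
    · exact C.levelAdj_of_setA hxA (h'.1 hxA)
    · exact C.levelAdj_of_setB ((C.mem_setB_iff h hx).2 hxA)
        ((C.mem_setB_iff h hy).2 fun hyA => hxA (h'.2 hyA))

open Classical in
lemma weightG_eq (x y : Fin n) : C.weightG n x y =
    ∑ r ∈ range (lastLevel ε), if C.LevelAdj n r x y then levelWeight ε r else 0 := by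
  refine sum_congr rfl fun r _ => ?_
  unfold LevelAdj levelWeight
  congr

lemma sum_levelWeight_le (q s : ℕ) :
    ∑ r ∈ Ico (q + 1) s, levelWeight ε r ≤ levelWeight ε q / 3 := by
  unfold levelWeight
  rw [← sum_div, sum_Ico_add' (fun r => ((4 : ℝ) ^ r)⁻¹) (q + 1) s 1]
  have h1 : Ico (q + 1 + 1) (s + 1) = Ioc (q + 1) s := by
    ext; simp only [mem_Ico, mem_Ioc]; omega
  have h2 := sum_Ioc_inv_four_pow_le (q + 1) s
  rw [h1]
  calc _ ≤ ((4 : ℝ) ^ (q + 1))⁻¹ / 3 / 4 ^ sqrtLog ε := by gcongr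
    _ = _ := by ring

lemma weightG_nonneg (x y : Fin n) : 0 ≤ C.weightG n x y := by
  classical
  rw [weightG_eq]
  refine sum_nonneg fun r _ => ?_
  split_ifs
  exacts [(levelWeight_pos ε r).le, le_rfl]

lemma weightG_le (x y : Fin n) : C.weightG n x y ≤ 1 / 3 := by
  classical
  rw [weightG_eq]
  have h1 : ∀ r ∈ range (lastLevel ε),
      (if C.LevelAdj n r x y then levelWeight ε r else 0) ≤ ((4 : ℝ) ^ (r + 1))⁻¹ := by
    intro r _
    have h0 : levelWeight ε r ≤ ((4 : ℝ) ^ (r + 1))⁻¹ :=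
      div_le_self (by positivity)
        (Real.one_le_rpow (by norm_num) (Real.sqrt_nonneg _))
    split_ifs
    · exact h0
    · positivity
  refine (sum_le_sum h1).trans ?_
  rw [range_eq_Ico, sum_Ico_add' (fun r => ((4 : ℝ) ^ r)⁻¹) 0 _ 1]
  have h2 : Ico (0 + 1) (lastLevel ε + 1) = Ioc 0 (lastLevel ε) := by
    ext; simp only [mem_Ico, mem_Ioc]; omega
  rw [h2]
  simpa using sum_Ioc_inv_four_pow_le 0 (lastLevel ε)

/-- Two points of a cluster of `P_q`, one of which is joined to `y` at level `q + 1` while the other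
is not, have different degrees in `G`. -/
lemma weightG_sub_bounds {q : ℕ} (hq : q + 1 ≤ lastLevel ε) (h : order q ∣ n) {i : Fin (order q)}
    {x x' y : Fin n} (hx : x ∈ cluster n q i) (hx' : x' ∈ cluster n q i)
    (hxy : C.LevelAdj n q x y) (hxy' : ¬ C.LevelAdj n q x' y) :
    2 / 3 * levelWeight ε q ≤ C.weightG n x y - C.weightG n x' y ∧
      C.weightG n x y - C.weightG n x' y ≤ 4 / 3 * levelWeight ε q := by
  classical
  have hsplit : ∀ f : ℕ → ℝ, ∑ r ∈ range (lastLevel ε), f r =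
      ∑ r ∈ range q, f r + f q + ∑ r ∈ Ico (q + 1) (lastLevel ε), f r := fun f => by
    rw [← sum_range_succ, range_eq_Ico, range_eq_Ico, sum_Ico_consecutive f (Nat.zero_le _) hq]
  -- Adjacency at index `r < q` depends only on the cluster of `P_{r+1}`, and `r + 1 ≤ q`, so `x`
  -- and `x'` agree there.
  have hlow : ∑ r ∈ range q, (if C.LevelAdj n r x y then levelWeight ε r else 0) =
      ∑ r ∈ range q, (if C.LevelAdj n r x' y then levelWeight ε r else 0) := by
    refine sum_congr rfl fun r hr => ?_
    rw [mem_range] at hr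
    rw [if_congr (C.levelAdj_congr (label_eq_of_mem_cluster hr h hx hx') y) rfl rfl]
  have hhigh : ∀ z : Fin n,
      0 ≤ ∑ r ∈ Ico (q + 1) (lastLevel ε), (if C.LevelAdj n r z y then levelWeight ε r else 0) ∧
      ∑ r ∈ Ico (q + 1) (lastLevel ε), (if C.LevelAdj n r z y then levelWeight ε r else 0) ≤
        levelWeight ε q / 3 := by
    intro z
    constructor
    · refine sum_nonneg fun r _ => ?_
      split_ifs
      exacts [(levelWeight_pos ε r).le, le_rfl]
    · refine le_trans (sum_le_sum fun r _ => ?_) (sum_levelWeight_le q (lastLevel ε))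
      split_ifs
      exacts [le_rfl, (levelWeight_pos ε r).le]
  rw [weightG_eq, weightG_eq, hsplit, hsplit, hlow, if_pos hxy, if_neg hxy']
  have h1 := hhigh x
  have h2 := hhigh x'
  constructor <;> linarith [h1.1, h1.2, h2.1, h2.2]

/-! ### The traps -/

open Classical in
/-- The indicator function of the pairs that receive weight from the `g`-th trap. -/
noncomputable def trapInd (n g : ℕ) (x y : Fin n) : ℝ :=
  if ∃ i j : Fin (order (trapLevel ε g)), (C.O g).Adj i j ∧
    x ∈ cluster n (trapLevel ε g) i ∧ y ∈ cluster n (trapLevel ε g) j then 1 else 0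

lemma trapInd_nonneg (g : ℕ) (x y : Fin n) : 0 ≤ C.trapInd n g x y := by
  unfold trapInd; split_ifs <;> norm_num

lemma trapInd_le_one (g : ℕ) (x y : Fin n) : C.trapInd n g x y ≤ 1 := by
  unfold trapInd; split_ifs <;> norm_num

lemma trapInd_eq_zero_or_one (g : ℕ) (x y : Fin n) :
    C.trapInd n g x y = 0 ∨ C.trapInd n g x y = 1 := by
  unfold trapInd; split_ifs <;> simp

lemma weightTraps_eq (x y : Fin n) :
    C.weightTraps n x y = ∑ g ∈ Icc 1 (numTraps ε), ((4 : ℝ) ^ g)⁻¹ * C.trapInd n g x y := by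
  simp only [weightTraps, trapInd, mul_ite, mul_one, mul_zero]

lemma weightTraps_nonneg (x y : Fin n) : 0 ≤ C.weightTraps n x y := by
  rw [weightTraps_eq]
  exact sum_nonneg fun g _ => mul_nonneg (by positivity) (C.trapInd_nonneg g x y)

lemma weightTraps_le (x y : Fin n) : C.weightTraps n x y ≤ 1 / 3 := by
  rw [weightTraps_eq]
  have h1 : ∀ g ∈ Icc 1 (numTraps ε), ((4 : ℝ) ^ g)⁻¹ * C.trapInd n g x y ≤ ((4 : ℝ) ^ g)⁻¹ :=
    fun g _ => mul_le_of_le_one_right (by positivity) (C.trapInd_le_one g x y)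
  refine (sum_le_sum h1).trans ?_
  have h2 : Icc 1 (numTraps ε) = Ioc 0 (numTraps ε) := by
    ext; simp only [mem_Icc, mem_Ioc]; omega
  rw [h2]
  simpa using sum_Ioc_inv_four_pow_le 0 (numTraps ε)

lemma weightH_nonneg (x y : Fin n) : 0 ≤ C.weightH n x y :=
  add_nonneg (C.weightG_nonneg x y) (C.weightTraps_nonneg x y)

lemma weightH_le_one (x y : Fin n) : C.weightH n x y ≤ 1 := by
  have h1 := C.weightG_le x y
  have h2 := C.weightTraps_le x y
  unfold weightH
  linarith

open Classical in
lemma trapInd_congr {g : ℕ} {x x' : Fin n}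
    (hx : (x : ℕ) / (n / order (trapLevel ε g)) = (x' : ℕ) / (n / order (trapLevel ε g)))
    (y : Fin n) : C.trapInd n g x y = C.trapInd n g x' y := by
  refine if_congr (exists_congr fun i => exists_congr fun j => ?_) rfl rfl
  rw [mem_cluster, mem_cluster, mem_cluster, hx]

open Classical in
lemma trapInd_eq {g : ℕ} (h : order (trapLevel ε g) ∣ n) (x y : Fin n) :
    C.trapInd n g x y = if (C.O g).Adj (label h x) (label h y) then 1 else 0 := by
  unfold trapInd
  refine if_congr ⟨?_, fun hadj => ⟨_, _, hadj, (mem_cluster_iff_label h).2 rfl,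
    (mem_cluster_iff_label h).2 rfl⟩⟩ rfl rfl
  rintro ⟨i, j, hadj, hx, hy⟩
  rw [mem_cluster_iff_label h] at hx hy
  rwa [hx, hy]

/-- A set that is spread over the clusters of the level of a trap has density about one half to all
large sets in that trap. -/
lemma abs_sum_trapInd_le {g q k : ℕ} (hg1 : 1 ≤ g) (hgN : g ≤ numTraps ε) (hn : 0 < n)
    (hb : order (trapLevel ε g) ∣ n) (hq : q < trapLevel ε g) (hk : 200 ≤ k)
    (hklog : (k : ℝ) ≤ Real.logb 2 (order (trapLevel ε g))) {i j : Fin (order q)}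
    {Z W : Finset (Fin n)} (hZ : Z ⊆ cluster n q i) (hW : W ⊆ cluster n q j)
    (hsp : ∀ v : ℕ, ((Z.filter fun x : Fin n => (x : ℕ) / (n / order (trapLevel ε g)) = v).card : ℝ) ≤
      ((k : ℝ) ^ 7)⁻¹ * Z.card) :
    |∑ x ∈ Z, ∑ y ∈ W, (C.trapInd n g x y - 1 / 2)| ≤
      Z.card * (4 / k * (cluster n q j).card) := by
  classical
  set b := trapLevel ε g with hbdef
  have htrap := (C.isTrap g hg1 hgN).local_ q hq i j k hk hklog
  set c : Fin (order b) → Fin (order b) → ℝ := fun v u => (if (C.O g).Adj v u then 1 else 0) - 1 / 2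
    with hc
  have hkpos : (0 : ℝ) < k := by exact_mod_cast lt_of_lt_of_le (by norm_num) hk
  have hdpos : 0 < n / order b := Nat.div_pos (Nat.le_of_dvd hn hb) (order_pos b)
  have hqb : order q ∣ order b := order_dvd_order hq.le
  have hec : ∀ R R' : Finset (Fin (order b)), ∑ v ∈ R, ∑ u ∈ R', c v u =
      (edgeCount (C.O g) R R' : ℝ) - 1 / 2 * R.card * R'.card := by
    intro R R'
    simp only [hc, edgeCount, sum_sub_distrib, sum_const, nsmul_eq_mul]
    rw [← sum_product', card_filter]
    push_cast
    ring
  have key := abs_sum_sum_le_of_spread (P := cluster (order b) q i) (Q := cluster (order b) q j)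
    (c := c) (k := k) (by omega) (fun v u => by
      simp only [hc]
      split_ifs <;> rw [abs_le] <;> constructor <;> norm_num)
    (fun R hR R' hR' h1 h2 => by rw [hec]; exact htrap R hR R' hR' h1 h2)
    (p := label hb) (p' := label hb) (Z := Z) (W := W)
    (fun x hx => label_mem_cluster hq.le hb (hZ hx))
    (fun y hy => label_mem_cluster hq.le hb (hW hy))
    (F := (n / order b : ℕ)) (τ := ((k : ℝ) ^ 7)⁻¹) (by exact_mod_cast hdpos) (fun u => by
      rw [← card_cluster hb u]
      norm_cast
      refine card_le_card fun y hy => ?_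
      rw [mem_cluster_iff_label hb]
      exact (mem_filter.1 hy).2) (fun v => by
      convert hsp v using 4
      exact Fin.ext_iff)
  have hWc : (W.card : ℝ) ≤ (cluster n q j).card := by exact_mod_cast card_le_card hW
  have hmul : ((cluster (order b) q j).card : ℝ) * (n / order b : ℕ) = (cluster n q j).card := by
    rw [card_cluster hqb, card_cluster (hqb.trans hb)]
    norm_cast
    rw [mul_comm, Nat.div_mul_div_comm hb hqb, mul_comm (order b),
      Nat.mul_div_mul_right _ _ (order_pos b)]
  have hsum : ∑ x ∈ Z, ∑ y ∈ W, (C.trapInd n g x y - 1 / 2) =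
      ∑ x ∈ Z, ∑ y ∈ W, c (label hb x) (label hb y) := by
    simp only [C.trapInd_eq hb, hc]
  rw [hsum]
  refine key.trans ?_
  gcongr
  -- The spread threshold `k^(-7)` is chosen so that the `2k^6` exceptional clusters hold at most a
  -- proportion `2/k` of `Z`, matching the error `2/k` of the typical clusters.
  have h1 : 2 * (k : ℝ) ^ 6 * ((k : ℝ) ^ 7)⁻¹ = 2 / k := by
    rw [pow_succ (k : ℝ) 6]
    field_simp
  have h2 : 2 * ((cluster (order b) q j).card : ℝ) / k * (n / order b : ℕ) =
      2 / k * (cluster n q j).card := by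
    rw [← hmul]
    ring
  rw [h1, h2]
  have h3 : 2 / (k : ℝ) * W.card ≤ 2 / k * (cluster n q j).card := by gcongr
  calc _ ≤ 2 / (k : ℝ) * (cluster n q j).card + 2 / k * (cluster n q j).card := by linarith
    _ = _ := by ring

end Choices

/-! ### Averages and regular pairs -/

/-- The average of `f` over `A`. -/
noncomputable def avg {α : Type*} (A : Finset α) (f : α → ℝ) : ℝ := (∑ x ∈ A, f x) / A.card

section average

variable {α : Type*} {A B Z U U' : Finset α} {f : α → ℝ} {d : α → α → ℝ} {γ c : ℝ}

lemma le_avg (hA : A.Nonempty) (h : ∀ x ∈ A, c ≤ f x) : c ≤ avg A f := by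
  have hpos : (0 : ℝ) < A.card := by exact_mod_cast hA.card_pos
  rw [avg, le_div_iff₀ hpos]
  calc c * A.card = ∑ x ∈ A, c := by simp [mul_comm]
    _ ≤ _ := sum_le_sum h

lemma avg_le (hA : A.Nonempty) (h : ∀ x ∈ A, f x ≤ c) : avg A f ≤ c := by
  have hpos : (0 : ℝ) < A.card := by exact_mod_cast hA.card_pos
  rw [avg, div_le_iff₀ hpos]
  calc _ ≤ ∑ x ∈ A, c := sum_le_sum h
    _ = c * A.card := by simp [mul_comm]

lemma le_avg_sub_avg (hA : A.Nonempty) (hB : B.Nonempty) (h : ∀ x ∈ A, ∀ x' ∈ B, c ≤ f x - f x') :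
    c ≤ avg A f - avg B f := by
  obtain ⟨x₀, hx₀, hmin⟩ := A.exists_min_image f hA
  obtain ⟨x₁, hx₁, hmax⟩ := B.exists_max_image f hB
  linarith [le_avg hA hmin, avg_le hB hmax, h x₀ hx₀ x₁ hx₁]

lemma density_eq_sum_avg (d : α → α → ℝ) (A B : Finset α) :
    density d A B = (∑ y ∈ B, avg A fun x => d x y) / B.card := by
  unfold density avg
  rw [sum_comm, ← sum_div, div_div]

/-- If `U'` is large enough, regularity applies to both `(A, U')` and `(B, U')`. Otherwise `|U'| <
γ|U|`, and the trivial bound `1` at each point suffices. -/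
lemma abs_sum_avg_sub_avg_le (hd0 : ∀ x y, 0 ≤ d x y) (hd1 : ∀ x y, d x y ≤ 1) (hγ : 0 ≤ γ)
    (hreg : IsRegularPair d γ Z U) (hA : A.Nonempty) (hB : B.Nonempty) (hAZ : A ⊆ Z) (hBZ : B ⊆ Z)
    (hAc : γ * Z.card ≤ A.card) (hBc : γ * Z.card ≤ B.card) (hU : U' ⊆ U) :
    |∑ y ∈ U', ((avg A fun x => d x y) - avg B fun x => d x y)| ≤ 2 * γ * U.card := by
  have hle : (U'.card : ℝ) ≤ U.card := by exact_mod_cast card_le_card hU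
  rcases le_or_gt (γ * U.card) U'.card with h | h
  · rcases U'.eq_empty_or_nonempty with rfl | hne
    · simp only [sum_empty, abs_zero]
      positivity
    have hpos : (0 : ℝ) < U'.card := by exact_mod_cast hne.card_pos
    have h1 := abs_le.1 (hreg A hAZ U' hU hAc h)
    have h2 := abs_le.1 (hreg B hBZ U' hU hBc h)
    have h3 : |density d A U' - density d B U'| ≤ 2 * γ :=
      abs_le.2 ⟨by linarith, by linarith⟩
    rw [density_eq_sum_avg, density_eq_sum_avg, ← sub_div, ← sum_sub_distrib, abs_div,
      abs_of_pos hpos, div_le_iff₀ hpos] at h3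
    refine h3.trans ?_
    gcongr
  · have h1 : ∀ y ∈ U', |(avg A fun x => d x y) - avg B fun x => d x y| ≤ 1 := by
      intro y _
      have hA0 := le_avg (f := fun x => d x y) hA fun x _ => hd0 x y
      have hA1 := avg_le (f := fun x => d x y) hA fun x _ => hd1 x y
      have hB0 := le_avg (f := fun x => d x y) hB fun x _ => hd0 x y
      have hB1 := avg_le (f := fun x => d x y) hB fun x _ => hd1 x y
      exact abs_le.2 ⟨by linarith, by linarith⟩
    calc _ ≤ ∑ y ∈ U', (1 : ℝ) := (abs_sum_le_sum_abs _ _).trans (sum_le_sum h1)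
      _ = U'.card := by simp
      _ ≤ _ := by nlinarith

end average

/-- If all the pairs `(Z, U)`, `U ∈ S`, are regular, then the weighted degrees into two not too small
subsets of `Z` have close sums over any set of vertices that is covered by `S`. -/
lemma abs_sum_avg_sub_avg_le_of_cover {n : ℕ} {d : Fin n → Fin n → ℝ} {γ : ℝ}
    {A B Z X : Finset (Fin n)} {S : Finset (Finset (Fin n))}
    (hd0 : ∀ x y, 0 ≤ d x y) (hd1 : ∀ x y, d x y ≤ 1) (hγ : 0 ≤ γ)
    (hS : (S : Set (Finset (Fin n))).PairwiseDisjoint id)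
    (hreg : ∀ U ∈ S, IsRegularPair d γ Z U) (hA : A.Nonempty) (hB : B.Nonempty) (hAZ : A ⊆ Z)
    (hBZ : B ⊆ Z) (hAc : γ * Z.card ≤ A.card) (hBc : γ * Z.card ≤ B.card)
    (hSX : ∑ U ∈ S, (U.card : ℝ) ≤ 3 / 2 * X.card)
    {W : Finset (Fin n)} (hW : W ⊆ S.biUnion fun U => U ∩ X) :
    |∑ y ∈ W, ((avg A fun x => d x y) - avg B fun x => d x y)| ≤ 3 * γ * X.card := by
  have hWeq : W = S.biUnion fun U => W ∩ U := by
    ext y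
    simp only [mem_biUnion, mem_inter]
    refine ⟨fun hy => ?_, fun ⟨_, _, hy, _⟩ => hy⟩
    obtain ⟨U, hU, hyU⟩ := mem_biUnion.1 (hW hy)
    exact ⟨U, hU, hy, (mem_inter.1 hyU).1⟩
  have hdisj : (S : Set (Finset (Fin n))).PairwiseDisjoint fun U => W ∩ U :=
    fun U hU U' hU' hne => (hS hU hU' hne).mono inter_subset_right inter_subset_right
  rw [hWeq, sum_biUnion hdisj]
  refine (abs_sum_le_sum_abs _ _).trans 
    ((sum_le_sum (g := fun U => 2 * γ * (U.card : ℝ)) fun U hU =>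
      abs_sum_avg_sub_avg_le hd0 hd1 hγ (hreg U hU) hA hB hAZ hBZ hAc hBc
        inter_subset_right).trans ?_)
  calc ∑ U ∈ S, 2 * γ * (U.card : ℝ) = 2 * γ * ∑ U ∈ S, (U.card : ℝ) := by rw [mul_sum]
    _ ≤ 2 * γ * (3 / 2 * X.card) := by gcongr
    _ = _ := by ring

/-! ### Trap densities of subsets of `Z`, and the contradiction -/

namespace Choices

variable {ε : ℝ} (C : Choices ε) {n q : ℕ}

/-- The density of the `g`-th trap between `A` and `y`. -/
noncomputable def trapAvg (A : Finset (Fin n)) (g : ℕ) (y : Fin n) : ℝ :=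
  avg A fun x => C.trapInd n g x y

lemma avg_weightH (A : Finset (Fin n)) (y : Fin n) :
    (avg A fun x => C.weightH n x y) = (avg A fun x => C.weightG n x y) +
      ∑ g ∈ Icc 1 (numTraps ε), ((4 : ℝ) ^ g)⁻¹ * C.trapAvg A g y := by
  unfold trapAvg avg weightH
  simp_rw [weightTraps_eq]
  rw [sum_add_distrib, add_div]
  congr 1
  rw [sum_comm, sum_div]
  refine sum_congr rfl fun g _ => ?_
  rw [← mul_sum, mul_div_assoc]

/-- Applies the concentration dichotomy to the trap partitions: a trap with constant label on `Z'`
has a `0`-`1` density function, and the local trap property controls each trap over which `Z'` is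
spread. -/
lemma exists_subset_trapAvg (hL : 1024 ≤ Real.logb 2 (1 / ε)) (hn : 0 < n)
    (hdvd : ∀ r ≤ lastLevel ε, order r ∣ n) (hq : q + 1 ≤ lastLevel ε) {i : Fin (order q)}
    {Z : Finset (Fin n)} (hZ : Z.Nonempty) (hZi : Z ⊆ cluster n q i) :
    ∃ Z' ⊆ Z, Z'.Nonempty ∧
      ((trapParam ε q : ℝ) ^ 7)⁻¹ ^ numTraps ε * Z.card ≤ (Z'.card : ℝ) ∧ ∃ t ≤ numTraps ε,
        (∀ g, 1 ≤ g → g ≤ t → ∀ y, C.trapAvg Z' g y = 0 ∨ C.trapAvg Z' g y = 1) ∧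
        ∀ g, t < g → g ≤ numTraps ε → ∀ j, ∀ W ⊆ cluster n q j,
          |∑ y ∈ W, (C.trapAvg Z' g y - 1 / 2)| ≤ 4 / trapParam ε q * (cluster n q j).card := by
  classical
  have hk := trapParam_ge_256 ε q
  set k := trapParam ε q with hkdef
  have hk1 : (256 : ℝ) ≤ k := by exact_mod_cast hk
  have hk7 : (1 : ℝ) < (k : ℝ) ^ 7 := one_lt_pow₀ (by linarith) (by norm_num)
  have h10 := ten_le_trapLevel_one hL
  have hlev : ∀ g, 1 ≤ g → g ≤ numTraps ε → order (trapLevel ε g) ∣ n := fun g h1 h2 =>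
    hdvd _ (trapLevel_mono h10 h1 h2)
  obtain ⟨Z', hZ', hne, hcard, t, ht, hcon, hspr⟩ := exists_subset_concentrated_spread
    (fun g (x : Fin n) => (x : ℕ) / (n / order (trapLevel ε g))) (numTraps ε)
    (fun g g' h1 h2 h3 x y hxy => by
      rw [div_cluster_size (trapLevel_mono h10 h1 h2) (hlev g' (h1.trans h2) h3),
        div_cluster_size (trapLevel_mono h10 h1 h2) (hlev g' (h1.trans h2) h3), hxy])
    (τ := ((k : ℝ) ^ 7)⁻¹) (by positivity) (inv_le_one_of_one_le₀ hk7.le) hZ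
  have hpos : (0 : ℝ) < Z'.card := by exact_mod_cast hne.card_pos
  refine ⟨Z', hZ', hne, hcard, t, ht, fun g h1 h2 y => ?_, fun g h1 h2 j W hW => ?_⟩
  · obtain ⟨x₀, hx₀⟩ := hne
    have : C.trapAvg Z' g y = C.trapInd n g x₀ y := by
      unfold trapAvg avg
      rw [sum_congr rfl fun x hx => C.trapInd_congr (hcon g h1 h2 x hx x₀ hx₀) y, sum_const,
        nsmul_eq_mul]
      field_simp
    rw [this]
    exact C.trapInd_eq_zero_or_one g x₀ y
  · have hg1 : 1 ≤ g := by omega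
    -- At a level at or above `P_q` in the refinement order, the whole of `Z'` lies in one cluster
    -- and so cannot be spread.
    have hqg : q < trapLevel ε g := by
      by_contra hcon'
      push Not at hcon'
      obtain ⟨x₀, hx₀⟩ := hne
      have h3 := hspr g h1 h2 ((x₀ : ℕ) / (n / order (trapLevel ε g)))
      rw [filter_true_of_mem fun x hx =>
        label_eq_of_mem_cluster hcon' (hdvd q (by omega)) (hZi (hZ' hx)) (hZi (hZ' hx₀))] at h3
      have h4 : ((k : ℝ) ^ 7)⁻¹ < 1 := inv_lt_one_of_one_lt₀ hk7
      nlinarith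
    have h3 := C.abs_sum_trapInd_le hg1 h2 hn (hlev g hg1 h2) hqg (k := k) (by omega)
      (trapParam_le_logb_order hL hg1 hqg) (hZ'.trans hZi) hW (hspr g h1 h2)
    have h4 : ∑ x ∈ Z', ∑ y ∈ W, (C.trapInd n g x y - 1 / 2) =
        Z'.card * ∑ y ∈ W, (C.trapAvg Z' g y - 1 / 2) := by
      rw [sum_comm, mul_sum]
      refine sum_congr rfl fun y _ => ?_
      unfold trapAvg avg
      rw [sum_sub_distrib, sum_const, nsmul_eq_mul]
      field_simp
    rw [h4, abs_mul, abs_of_pos hpos] at h3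
    exact le_of_mul_le_mul_left h3 hpos

lemma trapAvg_nonneg {A : Finset (Fin n)} (hA : A.Nonempty) (g : ℕ) (y : Fin n) :
    0 ≤ C.trapAvg A g y := le_avg hA fun x _ => C.trapInd_nonneg g x y

lemma trapAvg_le_one {A : Finset (Fin n)} (hA : A.Nonempty) (g : ℕ) (y : Fin n) :
    C.trapAvg A g y ≤ 1 := avg_le hA fun x _ => C.trapInd_le_one g x y

/-- The sets `U` such that the pair `(Z, U)` is regular cannot cover a fifth of `X_j`. -/
theorem false_of_regular_cover (hL : 1024 ≤ Real.logb 2 (1 / ε)) (hn : 0 < n)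
    (hdvd : ∀ r ≤ lastLevel ε, order r ∣ n) {γ β : ℝ} (hγ : 0 < γ) (hγε : γ ≤ ε)
    (hγβ : γ ^ (1 / 4 : ℝ) ≤ β) (hq : q + 1 ≤ lastLevel ε)
    (hqγ : ((q + 1 : ℕ) : ℝ) < Real.logb 2 (1 / γ) / (10 * √(Real.logb 2 (1 / ε))))
    {Z : Finset (Fin n)} (hZ : Z.Nonempty) {i j : Fin (order q)}
    (hZA : β ^ 2 * (Z.card : ℝ) ≤ ((Z ∩ C.setA n q i j).card : ℝ))
    (hZB : β ^ 2 * (Z.card : ℝ) ≤ ((Z ∩ C.setB n q i j).card : ℝ))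
    {S : Finset (Finset (Fin n))} (hS : (S : Set (Finset (Fin n))).PairwiseDisjoint id)
    (hreg : ∀ U ∈ S, IsRegularPair (C.weightH n) γ Z U)
    (hSX : ∑ U ∈ S, (U.card : ℝ) ≤ 3 / 2 * (cluster n q j).card)
    (hcover : ((cluster n q j).card : ℝ) ≤
      5 * (S.biUnion fun U => U ∩ cluster n q j).card) : False := by
  have hZpos : (0 : ℝ) < Z.card := by exact_mod_cast hZ.card_pos
  have hβ : 0 < β := lt_of_lt_of_le (by positivity) hγβ
  have hβ2 : γ ^ (1 / 2 : ℝ) ≤ β ^ 2 := by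
    calc γ ^ (1 / 2 : ℝ) = (γ ^ (1 / 4 : ℝ)) ^ 2 := by
          rw [← Real.rpow_natCast, ← Real.rpow_mul hγ.le]; norm_num
      _ ≤ _ := by gcongr
  have hτ := sqrt_le_trapParam_pow hL hγ hγε hqγ
  have hγsq : γ = γ ^ (1 / 2 : ℝ) * γ ^ (1 / 2 : ℝ) := by
    rw [← Real.rpow_add hγ]; norm_num
  have hdq := hdvd (q + 1) hq
  have hne : ∀ T : Finset (Fin n), β ^ 2 * (Z.card : ℝ) ≤ (T.card : ℝ) → T.Nonempty := by
    intro T hT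
    rw [← card_pos]
    have : (0 : ℝ) < T.card := lt_of_lt_of_le (mul_pos (pow_pos hβ 2) hZpos) hT
    exact_mod_cast this
  -- `γ = √γ · √γ`: one factor pays for helpfulness, the other for concentration, so regularity
  -- still applies to `A` and `B`.
  have hbig : ∀ T T' : Finset (Fin n), β ^ 2 * (Z.card : ℝ) ≤ (T.card : ℝ) →
      ((trapParam ε q : ℝ) ^ 7)⁻¹ ^ numTraps ε * T.card ≤ (T'.card : ℝ) →
      γ * Z.card ≤ T'.card := by
    intro T T' h1 h2
    calc γ * Z.card = γ ^ (1 / 2 : ℝ) * (γ ^ (1 / 2 : ℝ) * Z.card) := by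
          nth_rw 1 [hγsq]; ring
      _ ≤ ((trapParam ε q : ℝ) ^ 7)⁻¹ ^ numTraps ε * (β ^ 2 * Z.card) :=
        mul_le_mul hτ (mul_le_mul_of_nonneg_right hβ2 hZpos.le)
          (mul_nonneg (Real.rpow_nonneg hγ.le _) hZpos.le) (by positivity)
      _ ≤ ((trapParam ε q : ℝ) ^ 7)⁻¹ ^ numTraps ε * T.card := by gcongr
      _ ≤ _ := h2
  obtain ⟨A, hAs, hA, hAc, tA, htA, hA1, hA2⟩ := C.exists_subset_trapAvg hL hn hdvd hq
    (hne _ hZA) (inter_subset_right.trans (C.setA_subset hdq i j))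
  obtain ⟨B, hBs, hB, hBc, tB, htB, hB1, hB2⟩ := C.exists_subset_trapAvg hL hn hdvd hq
    (hne _ hZB) (inter_subset_right.trans (C.setB_subset hdq i j))
  have hxA : ∀ x ∈ A, x ∈ C.setA n q i j := fun x hx => (mem_inter.1 (hAs hx)).2
  have hxB : ∀ x ∈ B, x ∈ C.setB n q i j := fun x hx => (mem_inter.1 (hBs hx)).2
  have hxAi : ∀ x ∈ A, x ∈ cluster n q i := fun x hx => C.setA_subset hdq i j (hxA x hx)
  have hxBi : ∀ x ∈ B, x ∈ cluster n q i := fun x hx => C.setB_subset hdq i j (hxB x hx)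
  have hxB' : ∀ x ∈ B, x ∉ C.setA n q i j := fun x hx =>
    (C.mem_setB_iff hdq (hxBi x hx)).1 (hxB x hx)
  have hX : (cluster n q j).Nonempty := by
    rw [← card_pos, card_cluster (hdvd q (by omega))]
    exact Nat.div_pos (Nat.le_of_dvd hn (hdvd q (by omega))) (order_pos q)
  have hη := levelWeight_pos ε q
  have hk := trapParam_ge_256 ε q
  have hk' : (256 : ℝ) ≤ trapParam ε q := by exact_mod_cast hk
  refine false_of_small_partial_sums (X := cluster n q j)
    (W := S.biUnion fun U => U ∩ cluster n q j) (H := fun y => y ∈ C.setA n q j i)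
    (G := fun y => (avg A fun x => C.weightG n x y) - avg B fun x => C.weightG n x y)
    (a := C.trapAvg A) (b := C.trapAvg B) (η := levelWeight ε q) (γ := γ) (N := numTraps ε)
    (κ := 4 / trapParam ε q) hX (biUnion_subset.2 fun U _ => inter_subset_right) hcover
    hη (le_levelWeight hL hγ hγε hqγ) (fun t ht => levelWeight_le_trapWeight hL ht)
    (by positivity) ?_ ?_ (C.trapAvg_nonneg hA) (C.trapAvg_le_one hA) (C.trapAvg_nonneg hB)
    (C.trapAvg_le_one hB) htA htB (fun g h1 h2 y _ => hA1 g h1 h2 y)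
    (fun g h1 h2 y _ => hB1 g h1 h2 y) (fun g h1 h2 => hA2 g h1 h2 j)
    (fun g h1 h2 => hB2 g h1 h2 j) ?_ ?_ ?_
  · rw [div_le_iff₀ (by linarith)]
    linarith
  · have := trapParam_ge ε q
    rw [div_le_iff₀ hη] at this
    rw [div_le_iff₀ (by linarith)]
    linarith
  · intro y hy hH
    -- For `y ∈ A_{j,i}` all of `A` and none of `B` is joined to `y` at level `q + 1`; in the other
    -- case the roles are exchanged and the sign flips.
    have key : ∀ x ∈ A, ∀ x' ∈ B, _ := fun x hx x' hx' =>
      C.weightG_sub_bounds hq (hdvd q (by omega)) (hxAi x hx) (hxBi x' hx')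
        (y := y) ((C.levelAdj_iff hdq (hxAi x hx) hy).2 (iff_of_true (hxA x hx) hH))
        fun h => hxB' x' hx' (((C.levelAdj_iff hdq (hxBi x' hx') hy).1 h).2 hH)
    have h1 := le_avg_sub_avg (f := fun x => C.weightG n x y) hA hB
      fun x hx x' hx' => (key x hx x' hx').1
    have h2 := le_avg_sub_avg (f := fun x => C.weightG n x y) (c := -(4 / 3 * levelWeight ε q)) hB hA
      fun x' hx' x hx => by linarith [(key x hx x' hx').2]
    constructor <;> linarith
  · intro y hy hH
    have key : ∀ x ∈ A, ∀ x' ∈ B, _ := fun x hx x' hx' =>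
      C.weightG_sub_bounds hq (hdvd q (by omega)) (hxBi x' hx') (hxAi x hx)
        (y := y) ((C.levelAdj_iff hdq (hxBi x' hx') hy).2 (iff_of_false (hxB' x' hx') hH))
        fun h => hH (((C.levelAdj_iff hdq (hxAi x hx) hy).1 h).1 (hxA x hx))
    have h1 := le_avg_sub_avg (f := fun x => C.weightG n x y) hB hA
      fun x' hx' x hx => (key x hx x' hx').1
    have h2 := le_avg_sub_avg (f := fun x => C.weightG n x y) (c := -(4 / 3 * levelWeight ε q)) hA hB
      fun x hx x' hx' => by linarith [(key x hx x' hx').2]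
    constructor <;> linarith
  · intro W hW
    have h1 := abs_sum_avg_sub_avg_le_of_cover C.weightH_nonneg C.weightH_le_one hγ.le hS hreg hA hB
      (hAs.trans inter_subset_left) (hBs.trans inter_subset_left) (hbig _ _ hZA hAc)
      (hbig _ _ hZB hBc) hSX hW
    convert h1 using 3 with y
    rw [avg_weightH, avg_weightH]
    simp_rw [mul_sub]
    rw [sum_sub_distrib]
    ring

end Choices

/-! ### Counting: from regular pairs to a cover of a fifth of `X_j` -/

/-- A nonempty set is contained in at most one cluster, up to a small proportion. -/
lemma betaSubset_unique {n q : ℕ} {β : ℝ} (hβ : β ≤ 1 / 100) {Z : Finset (Fin n)} (hZ : Z.Nonempty)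
    {i i' : Fin (order q)} (h : BetaSubset β Z (cluster n q i))
    (h' : BetaSubset β Z (cluster n q i')) : i = i' := by
  by_contra hne
  have hZpos : (0 : ℝ) < Z.card := by exact_mod_cast hZ.card_pos
  have hdisj : Disjoint (Z ∩ cluster n q i) (Z ∩ cluster n q i') := disjoint_left.2 fun x hx hx' =>
    hne (cluster_disjoint (mem_inter.1 hx).2 (mem_inter.1 hx').2)
  have h1 : ((Z ∩ cluster n q i).card : ℝ) + (Z ∩ cluster n q i').card ≤ Z.card := by
    rw [← Nat.cast_add, ← card_union_of_disjoint hdisj]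
    exact_mod_cast card_le_card (union_subset inter_subset_left inter_subset_left)
  unfold BetaSubset at h h'
  nlinarith

end StrongReg

/-- Here `q = r - 1`, so that `P_q` is `P_{r-1}`, with `m = order q` clusters; `k = 𝒵.parts.card`. -/
theorem mainTheorem5 :
    ∃ ε₀ : ℝ, 0 < ε₀ ∧ ∀ ε : ℝ, 0 < ε → ε ≤ ε₀ →
      ∀ C : StrongReg.Choices ε,
      ∀ n : ℕ, 0 < n → (∀ r ≤ StrongReg.lastLevel ε, StrongReg.order r ∣ n) →
      ∀ γ β : ℝ, 0 < γ → γ ≤ ε → γ ^ (1 / 4 : ℝ) ≤ β → β ≤ 1 / 100 →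
      ∀ q : ℕ, q + 1 ≤ StrongReg.lastLevel ε →
        ((q + 1 : ℕ) : ℝ) < Real.logb 2 (1 / γ) / (10 * √(Real.logb 2 (1 / ε))) →
      ∀ 𝒵 : Finpartition (Finset.univ : Finset (Fin n)),
        (∀ Z ∈ 𝒵.parts, ∀ Z' ∈ 𝒵.parts, Z.card = Z'.card) →
      ∀ Z ∈ 𝒵.parts, ∀ i j : Fin (StrongReg.order q),
        StrongReg.BetaSubset β Z (StrongReg.cluster n q i) →
      ∀ S ⊆ 𝒵.parts,
        (∀ U ∈ S, StrongReg.BetaSubset β U (StrongReg.cluster n q j) ∧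
          C.IsHelpful n q β Z U) →
        (𝒵.parts.card : ℝ) / (2 * (StrongReg.order q : ℝ)) ≤ (S.card : ℝ) →
        ∃ S' ⊆ S, (𝒵.parts.card : ℝ) / (4 * (StrongReg.order q : ℝ)) ≤ (S'.card : ℝ) ∧
          ∀ U ∈ S', ¬ StrongReg.IsRegularPair (C.weightH n) γ Z U := by
  classical
  -- This makes `log (1/ε) ≥ 1024`, hence `w(1) ≥ 10`, where the tower bound starts, and `√(log
  -- (1/ε)) ≥ 32`.
  refine ⟨(2 : ℝ) ^ (-1024 : ℝ), by positivity, ?_⟩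
  intro ε hε hε₀ C n hn hdvd γ β hγ hγε hγβ hβ q hq hqγ 𝒵 heq Z hZ i j hZi S hS hSU hScard
  have hL : 1024 ≤ Real.logb 2 (1 / ε) := by
    rw [Real.le_logb_iff_rpow_le (by norm_num) (by positivity), le_one_div (by positivity) hε]
    rw [Real.rpow_neg (by norm_num)] at hε₀
    simpa using hε₀
  refine ⟨S.filter fun U => ¬ StrongReg.IsRegularPair (C.weightH n) γ Z U, S.filter_subset _, ?_,
    fun U hU => (Finset.mem_filter.1 hU).2⟩
  by_contra hcon
  push Not at hcon
  set R := S.filter fun U => StrongReg.IsRegularPair (C.weightH n) γ Z U with hR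
  have hRS : R ⊆ S := S.filter_subset _
  have hsum : (R.card : ℝ) +
      (S.filter fun U => ¬ StrongReg.IsRegularPair (C.weightH n) γ Z U).card = S.card := by
    exact_mod_cast Finset.card_filter_add_card_filter_not (s := S) _
  have hm : (0 : ℝ) < StrongReg.order q := by exact_mod_cast StrongReg.order_pos q
  have hK : (0 : ℝ) < 𝒵.parts.card := by exact_mod_cast Finset.card_pos.2 ⟨Z, hZ⟩
  have hRcard : (𝒵.parts.card : ℝ) / (4 * StrongReg.order q) ≤ R.card := by
    have : (𝒵.parts.card : ℝ) / (2 * StrongReg.order q) =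
        2 * (𝒵.parts.card / (4 * StrongReg.order q)) := by
      field_simp
      norm_num
    linarith
  have hZne : Z.Nonempty := 𝒵.nonempty_of_mem_parts hZ
  obtain ⟨U₀, hU₀⟩ : R.Nonempty := by
    rw [← Finset.card_pos]
    have : (0 : ℝ) < R.card := lt_of_lt_of_le (by positivity) hRcard
    exact_mod_cast this
  -- Helpfulness supplies its own indices. They must be `i` and `j`, as a nonempty set cannot lie
  -- almost entirely in two clusters. A single regular `U₀` suffices, because the resulting bound
  -- concerns only `Z`.
  obtain ⟨i', j', h1, h2, h3⟩ := (hSU U₀ (hRS hU₀)).2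
  obtain rfl := StrongReg.betaSubset_unique hβ hZne hZi h1
  obtain rfl := StrongReg.betaSubset_unique hβ (𝒵.nonempty_of_mem_parts (hS (hRS hU₀)))
    (hSU U₀ (hRS hU₀)).1 h2
  have hdisj : (R : Set (Finset (Fin n))).PairwiseDisjoint id :=
    𝒵.disjoint.subset (Finset.coe_subset.2 (hRS.trans hS))
  have hcardX : (StrongReg.order q : ℝ) * (StrongReg.cluster n q j).card = n := by
    rw [StrongReg.card_cluster (hdvd q (by omega))]
    exact_mod_cast Nat.mul_div_cancel' (hdvd q (by omega))
  have hn' : (𝒵.parts.card : ℝ) * Z.card = n := by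
    have h4 := 𝒵.sum_card_parts
    rw [Finset.sum_congr rfl fun U hU => heq U hU Z hZ, Finset.sum_const, smul_eq_mul,
      Finset.card_univ, Fintype.card_fin] at h4
    exact_mod_cast h4
  have hcover : ((R.biUnion fun U => U ∩ StrongReg.cluster n q j).card : ℝ) =
      ∑ U ∈ R, ((U ∩ StrongReg.cluster n q j).card : ℝ) := by
    have hdisj' : ∀ U ∈ R, ∀ U' ∈ R, U ≠ U' →
        Disjoint (U ∩ StrongReg.cluster n q j) (U' ∩ StrongReg.cluster n q j) :=
      fun U hU U' hU' hne =>
        (hdisj hU hU' hne).mono Finset.inter_subset_left Finset.inter_subset_left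
    rw [Finset.card_biUnion hdisj']
    push_cast
    rfl
  have hlow : 99 / 100 * ∑ U ∈ R, (U.card : ℝ) ≤
      ∑ U ∈ R, ((U ∩ StrongReg.cluster n q j).card : ℝ) := by
    rw [Finset.mul_sum]
    refine Finset.sum_le_sum fun U hU => le_trans ?_ (hSU U (hRS hU)).1
    gcongr
    linarith
  have hsumR : ∑ U ∈ R, (U.card : ℝ) = R.card * Z.card := by
    rw [Finset.sum_congr rfl fun U hU => by rw [heq U (hS (hRS hU)) Z hZ], Finset.sum_const,
      nsmul_eq_mul]
  have hsub : ((R.biUnion fun U => U ∩ StrongReg.cluster n q j).card : ℝ) ≤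
      (StrongReg.cluster n q j).card := by
    exact_mod_cast Finset.card_le_card
      (Finset.biUnion_subset.2 fun U _ => Finset.inter_subset_right)
  refine C.false_of_regular_cover hL hn hdvd hγ hγε hγβ hq hqγ hZne (i := i) (j := j)
    (h3.trans (min_le_left _ _)) (h3.trans (min_le_right _ _)) hdisj
    (fun U hU => (Finset.mem_filter.1 hU).2) (by linarith) ?_
  -- A family of `k/(4m)` parts has total size `|X_j|/4`; since `β ≤ 1/100`, at least `99/100` of it
  -- lies in `X_j`, which is more than a fifth of `X_j`.
  have h5 : ((StrongReg.cluster n q j).card : ℝ) =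
      4 * (𝒵.parts.card / (4 * StrongReg.order q) * Z.card) := by
    field_simp
    linarith
  have h6 : (𝒵.parts.card : ℝ) / (4 * StrongReg.order q) * Z.card ≤ R.card * Z.card := by gcongr
  have h7 : (0 : ℝ) ≤ (StrongReg.cluster n q j).card := by positivity
  linarith
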